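/- Setting. Let $d\ge 2$. A Nambu micro-graph over $\mathbb{R}^d$ with one sink $0$ and three copies of the Nambu bracket has, for each copy $b\in\{1,2,3\}$, a Levi-Civita vertex $b$ and $d-2$ terminal Casimir vertices $a^1_b,\dots,a^{d-2}_b$; from the vertex $b$ an ordered $d$-tuple of edges is issued, of which the last $d-2$ go to $a^1_b,\dots,a^{d-2}_b$. For $d=2$ this is a Kontsevich graph built of three wedges. Micro-graphs are identified with their encodings, i.e. with the heads of all (labelled, ordered) edges. The formula $\phi(\Gamma)$ is the differential operator in one argument $f$ (placed in the sink), depending on smooth functions $\varrho,a^1,\dots,a^{d-2}$ on $\mathbb{R}^d$, $$\phi(\Gamma)=\sum_{\vec\imath_1,\vec\imath_2,\vec\imath_3\in\{1,\dots,d\}^d}\ \prod_{b=1}^{3}\varepsilon^{\vec\imath_b}\ \prod_{v}\Bigl(\prod_{e\to v}\partial_{i(e)}\Bigr)(\text{content of }v),$$ where $i(e)$ is the index of the edge $e$, and the content of a vertex $v$ is $f$ in the sink, $\varrho$ in each Levi-Civita vertex and $a^k$ in each vertex $a^k_b$. The micro-graph vanishes if $\phi(\Gamma)=0$ identically, for all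 smooth $\varrho,a^1,\dots,a^{d-2},f$. The sunflower consists of the two Kontsevich graphs $(0,1;1,3;1,2)$ and $(0,2;1,3;1,2)$. Its $d$-dimensional descendants are obtained by letting every edge issued from a wedge top and entering another wedge top $b$ run, independently from the other edges, over the $d-1$ vertices $b,a^1_b,\dots,a^{d-2}_b$; the other edges stay. The 4D-descendants of a 3D micro-graph are obtained by attaching a new Casimir vertex $a^2_b$ to each copy $b$, and letting every edge which enters the Casimir $a^1_b$ of a copy other than its own run, independently, over $a^1_b$ and $a^2_b$; the other edges stay. Let $\mathrm{Van}_d$ be the set of vanishing $d$-dimensional descendants of the sunflower. Proposition 1. The sunflower has 48 3D-descendants, of which exactly 13 vanish; up to isomorphism (permutations of the three copies and swaps of the first two edges of a copy) the vanishing ones are twelve. It has 324 4D-descendants, of which exactly 54 vanish. The set $\mathrm{Van}_{d=3}$ has 118 4D-descendants, and $$\mathrm{Van}_{d=4}=\{\Gamma : \Gamma\text{ is a 4D-descendant of a micro-graph in }\mathrm{Van}_{d=3}\text{ and }\phi(\Gamma)=0\}.$$ -/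

import Mathlib

open scoped ContDiff

namespace NambuMicro

/-- Vertices of a Nambu micro-graph with `m` sinks, built of `n` copies of the Nambu bracket with
`c` Casimirs (so over dimension `d = c + 2`): the sinks, the Levi-Civita vertex `top b` of the
copy `b`, and the terminal vertex `casimir k b` with the Casimir number `k` in the copy `b`. -/
inductive Vertex (m n c : ℕ) : Type
  | sink (j : Fin m) : Vertex m n c
  | top (b : Fin n) : Vertex m n c
  | casimir (k : Fin c) (b : Fin n) : Vertex m n c
  deriving DecidableEq

/-- A Nambu micro-graph over dimension `c + 2`. Out of the `c + 2` ordered edges issued from the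
Levi-Civita vertex of every copy of the bracket, the last `c` go to the Casimirs of that copy;
hence the graph is given by the heads of the first two (Left and Right) edges of every copy. -/
abbrev MicroGraph (m n c : ℕ) : Type := Fin n → Fin 2 → Vertex m n c

/-- A Kontsevich graph built of `n` wedges over `m` sinks: there are no Casimirs. -/
abbrev KontsevichGraph (m n : ℕ) : Type := MicroGraph m n 0

section Formula

variable {m n c : ℕ}

/-- The encoding of a micro-graph: the ordered tuple of heads of the `c + 2` edges issued from
the Levi-Civita vertex of the copy `b`. -/
def head (G : MicroGraph m n c) (b : Fin n) : Fin (c + 2) → Vertex m n c :=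
  Matrix.vecCons (G b 0) (Matrix.vecCons (G b 1) fun k => Vertex.casimir k b)

/-- The Levi-Civita symbol: the sign of `i` if `i` is a permutation, and zero otherwise. -/
noncomputable def leviCivita {d : ℕ} (i : Fin d → Fin d) : ℝ :=
  ∑ σ : Equiv.Perm (Fin d), if (σ : Fin d → Fin d) = i then ((Equiv.Perm.sign σ : ℤ) : ℝ) else 0

/-- The partial derivative of `g` along the `i`-th coordinate. -/
noncomputable def partialDeriv {d : ℕ} (i : Fin d) (g : (Fin d → ℝ) → ℝ) : (Fin d → ℝ) → ℝ :=
  fun x => fderiv ℝ g x (Pi.single i 1)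

/-- The iterated partial derivative along a list of coordinates. -/
noncomputable def iterPartial {d : ℕ} (l : List (Fin d)) (g : (Fin d → ℝ) → ℝ) :
    (Fin d → ℝ) → ℝ :=
  l.foldr partialDeriv g

/-- The summation indices of the edges that enter the vertex `v`, where `I b s` is the index
carried by the edge number `s` issued from the Levi-Civita vertex of the copy `b`. -/
def incoming (G : MicroGraph m n c) (I : Fin n → Fin (c + 2) → Fin (c + 2))
    (v : Vertex m n c) : List (Fin (c + 2)) :=
  (((List.finRange n).product (List.finRange (c + 2))).filter
    (fun e => head G e.1 e.2 = v)).map (fun e => I e.1 e.2)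

/-- The formula of a Nambu micro-graph: the polydifferential operator with arguments
`f 0, ..., f (m - 1)` in the sinks, for the Nambu bracket with coefficient `ρ` and Casimirs
`a 0, ..., a (c - 1)`. It is the sum, over all values of the indices of all edges, of the product
of the contents of all vertices; an incoming edge with index `i` differentiates the content of its
head along the `i`-th coordinate. -/
noncomputable def formula (G : MicroGraph m n c) (ρ : (Fin (c + 2) → ℝ) → ℝ)
    (a : Fin c → (Fin (c + 2) → ℝ) → ℝ) (f : Fin m → (Fin (c + 2) → ℝ) → ℝ)
    (x : Fin (c + 2) → ℝ) : ℝ :=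
  ∑ I : Fin n → Fin (c + 2) → Fin (c + 2),
    (∏ b : Fin n, leviCivita (I b) * iterPartial (incoming G I (Vertex.top b)) ρ x) *
    (∏ k : Fin c, ∏ b : Fin n, iterPartial (incoming G I (Vertex.casimir k b)) (a k) x) *
    (∏ j : Fin m, iterPartial (incoming G I (Vertex.sink j)) (f j) x)

/-- The formula of the micro-graph vanishes identically. -/
def Vanishes (G : MicroGraph m n c) : Prop :=
  ∀ (ρ : (Fin (c + 2) → ℝ) → ℝ) (a : Fin c → (Fin (c + 2) → ℝ) → ℝ)
    (f : Fin m → (Fin (c + 2) → ℝ) → ℝ),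
    ContDiff ℝ ∞ ρ → (∀ k, ContDiff ℝ ∞ (a k)) → (∀ j, ContDiff ℝ ∞ (f j)) →
    ∀ x, formula G ρ a f x = 0

end Formula

section Descendants

variable {m n c : ℕ}

/-- `H` is one of the micro-graphs over dimension `c + 2` that descend from the Kontsevich graph
`G`: every wedge is magnified to a copy of the Nambu bracket, and every arrow issued from another
copy independently runs, by the Leibniz rule, over the Levi-Civita vertex and the Casimirs of the
copy which it enters. An arrow from a wedge top to itself is not external and stays. -/
def DescendsFrom2D (G : KontsevichGraph m n) (H : MicroGraph m n c) : Prop :=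
  ∀ (b : Fin n) (s : Fin 2),
    match G b s with
    | Vertex.sink j => H b s = Vertex.sink j
    | Vertex.top b' => H b s = Vertex.top b' ∨ (b' ≠ b ∧ ∃ k, H b s = Vertex.casimir k b')
    | Vertex.casimir k _ => k.elim0

/-- `H` is one of the `(d + 1)`-dimensional descendants of the `d`-dimensional micro-graph `G`
(with `d = c + 2`): a new Casimir is attached to every copy of the bracket, and every arrow that
acted on a Casimir of another copy independently runs over its old target and the new Casimir
of that copy. All other arrows stay. -/
def IsDescendant (G : MicroGraph m n c) (H : MicroGraph m n (c + 1)) : Prop :=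
  ∀ (b : Fin n) (s : Fin 2),
    match G b s with
    | Vertex.sink j => H b s = Vertex.sink j
    | Vertex.top b' => H b s = Vertex.top b'
    | Vertex.casimir k b' => H b s = Vertex.casimir k.castSucc b' ∨
        (b' ≠ b ∧ H b s = Vertex.casimir (Fin.last c) b')

/-- Relabelling of vertices induced by a permutation of the copies of the bracket. -/
def Vertex.relabel (π : Equiv.Perm (Fin n)) : Vertex m n c → Vertex m n c
  | Vertex.sink j => Vertex.sink j
  | Vertex.top b => Vertex.top (π b)
  | Vertex.casimir k b => Vertex.casimir k (π b)

/-- Two micro-graphs are isomorphic if they differ by a permutation of the copies of the bracket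
and by the order Left, Right of the two free edges in each copy. -/
def Isomorphic (G H : MicroGraph m n c) : Prop :=
  ∃ (π : Equiv.Perm (Fin n)) (τ : Fin n → Equiv.Perm (Fin 2)),
    ∀ b s, H (π b) s = (G b (τ b s)).relabel π

end Descendants

/-- The two Kontsevich graphs `(0,1; 1,3; 1,2)` and `(0,2; 1,3; 1,2)` in the sunflower, over one
sink `0` and three wedge tops `1, 2, 3` (which are `top 0`, `top 1`, `top 2` here). -/
def sunflower : Set (KontsevichGraph 1 3) :=
  {![![Vertex.sink 0, Vertex.top 0], ![Vertex.top 0, Vertex.top 2],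
      ![Vertex.top 0, Vertex.top 1]],
    ![![Vertex.sink 0, Vertex.top 1], ![Vertex.top 0, Vertex.top 2],
      ![Vertex.top 0, Vertex.top 1]]}

/-- The descendants of the sunflower over dimension `c + 2`. -/
def sunflowerDescendants (c : ℕ) : Set (MicroGraph 1 3 c) :=
  {H | ∃ G ∈ sunflower, DescendsFrom2D G H}

/-- The descendants of the sunflower over dimension `c + 2` whose formula vanishes identically. -/
def sunflowerVan (c : ℕ) : Set (MicroGraph 1 3 c) :=
  {H | H ∈ sunflowerDescendants c ∧ Vanishes H}

/-- The `(d + 1)`-dimensional descendants of a set of `d`-dimensional micro-graphs. -/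
def descendants {m n c : ℕ} (S : Set (MicroGraph m n c)) : Set (MicroGraph m n (c + 1)) :=
  {H | ∃ G ∈ S, IsDescendant G H}

end NambuMicro

/-! At a fixed point, the formula of a micro-graph is a contraction of three Levi-Civita symbols
with the jets of the contents of the vertices. It depends only on the table of heads of the edges,
up to the symmetries below, so the claim reduces to a finite one about 48 and 324 tables.

Vanishing is certified for arbitrary jets. Reordering the edges of a copy multiplies the contraction
by a sign. Permuting the copies, or permuting vertices with equal content, does not change it. The
Plücker relation (`amplitude_exchange`) writes it as the sum of contractions in which one edge of a
copy is exchanged in turn with every edge of another copy. If these facts give A = z * A with an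
integer z ≠ 1, then A = 0. `provablyZero` searches for such certificates to bounded depth, and
`amplitude_eq_zero_of_provablyZero` is its soundness.

Non-vanishing is certified by a single integer. All contents are taken to be sums of exponentials,
each in one coordinate, and the formula is evaluated at the origin. Mixed derivatives of such a term
are zero, so choosing a term in a vertex fixes the indices of all edges that enter it. The
contraction becomes the finite recursion `expValue` (`contraction_eq_expValue`). One choice of
exponentials separates the non-vanishing graphs in dimension three, and three choices do so in
dimension four.

The descendants are in bijection with tuples of independent choices (`Key`). Each 4D-descendant
comes from exactly one 3D-descendant, obtained by merging the new Casimir with the old one in every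
choice (`keyOrigin`). The last equality therefore amounts to the check that the origin of every
vanishing 4D key is a vanishing 3D key (`test₄_spec`). -/

namespace NambuMicro

/-! ### Levi-Civita symbols: antisymmetry and the Plücker relation. -/

section LeviCivita

variable {d : ℕ}

theorem leviCivita_comp_perm (i : Fin d → Fin d) (τ : Equiv.Perm (Fin d)) :
    leviCivita (i ∘ τ) = ((Equiv.Perm.sign τ : ℤ) : ℝ) * leviCivita i := by
  unfold leviCivita
  rw [Finset.mul_sum, ← Equiv.sum_comp (Equiv.mulRight τ)]
  refine Finset.sum_congr rfl fun σ _ => ?_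
  have : ((σ * τ : Equiv.Perm (Fin d)) : Fin d → Fin d) = i ∘ τ ↔ (σ : Fin d → Fin d) = i := by
    rw [Equiv.Perm.coe_mul]
    exact τ.surjective.injective_comp_right.eq_iff
  simp only [Equiv.coe_mulRight, this, Equiv.Perm.sign_mul, mul_ite, mul_zero]
  split_ifs <;> push_cast <;> ring

theorem leviCivita_of_perm (τ : Equiv.Perm (Fin d)) :
    leviCivita τ = ((Equiv.Perm.sign τ : ℤ) : ℝ) := by
  unfold leviCivita
  simp [DFunLike.coe_fn_eq]

theorem leviCivita_of_not_injective {i : Fin d → Fin d} (hi : ¬ Function.Injective i) :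
    leviCivita i = 0 := by
  unfold leviCivita
  refine Finset.sum_eq_zero fun σ _ => if_neg ?_
  rintro rfl
  exact hi σ.injective

/-- The columns of the matrix are standard basis vectors. In this form Cramer's rule applies to a
product of two symbols. -/
theorem leviCivita_eq_det (i : Fin d → Fin d) :
    leviCivita i = (Matrix.of fun r s => if r = i s then (1 : ℝ) else 0).det := by
  rw [Matrix.det_apply]
  unfold leviCivita
  refine Finset.sum_congr rfl fun σ _ => ?_
  simp only [Matrix.of_apply, Finset.prod_ite_zero, Finset.prod_const_one, Finset.mem_univ,
    true_imp_iff, funext_iff]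
  split_ifs <;> simp [Units.smul_def]

theorem of_update (i : Fin d → Fin d) (a x : Fin d) :
    (Matrix.of fun r s => if r = Function.update i a x s then (1 : ℝ) else 0) =
      (Matrix.of fun r s => if r = i s then (1 : ℝ) else 0).updateCol a (Pi.single x 1) := by
  ext r s
  by_cases h : s = a
  · subst h; simp [Pi.single_apply]
  · simp [h]

/-- The Plücker relation for a product of two Levi-Civita symbols. -/
theorem leviCivita_exchange (i j : Fin d → Fin d) (a : Fin d) :
    leviCivita i * leviCivita j =
      ∑ s, leviCivita (Function.update i a (j s)) * leviCivita (Function.update j s (i a)) := by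
  simp only [leviCivita_eq_det, of_update]
  set A : Matrix (Fin d) (Fin d) ℝ := Matrix.of fun r s => if r = j s then (1 : ℝ) else 0 with hA
  set B : Matrix (Fin d) (Fin d) ℝ := Matrix.of fun r s => if r = i s then (1 : ℝ) else 0 with hB
  have hB' : B = B.updateCol a (Pi.single (i a) 1) := by
    rw [hB, ← of_update, Function.update_eq_self]
  have hcol : ∀ s, (fun r => A r s) = Pi.single (j s) 1 := by
    intro s; ext r; simp [hA, Pi.single_apply]
  -- Cramer's rule expands the column `a` of `B`, scaled by `A.det`, in the columns of `A`.
  -- Linearity of `B.det` in that column then gives the relation.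
  have hmul : A.det • (Pi.single (i a) 1 : Fin d → ℝ) =
      ∑ s, A.cramer (Pi.single (i a) 1) s • (Pi.single (j s) 1 : Fin d → ℝ) := by
    rw [← Matrix.mulVec_cramer]
    ext r
    simp only [Matrix.mulVec, dotProduct, Finset.sum_apply, Pi.smul_apply, ← hcol, smul_eq_mul]
    exact Finset.sum_congr rfl fun s _ => mul_comm _ _
  have hlin : ∀ v, (B.updateCol a v).det = Matrix.cramer B v a := fun v => by
    rw [Matrix.cramer_apply]
  calc B.det * A.det = A.det * (B.updateCol a (Pi.single (i a) 1)).det := by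
        rw [← hB', mul_comm]
    _ = Matrix.cramer B (A.det • (Pi.single (i a) 1 : Fin d → ℝ)) a := by
        rw [hlin, map_smul]; rfl
    _ = _ := by
        rw [hmul, map_sum, Finset.sum_apply]
        refine Finset.sum_congr rfl fun s _ => ?_
        rw [map_smul, hlin, Pi.smul_apply, smul_eq_mul, mul_comm, Matrix.cramer_apply A]

end LeviCivita

/-! ### Contractions along tables of heads, with arbitrary jets, and their symmetries. -/

section Amplitude

variable {n d : ℕ}

/-- The class of a numbered vertex: the vertices of one class have the same content. The sink is
`0`, and the vertices `1 + 3 * x + b` with `b < 3` form the class `x + 1`. -/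
def codeClass (v : ℕ) : ℕ := (v + 2) / 3

/-- The indices carried by the edges with head `v`. -/
def incomingIndices (h : Fin n × Fin d → ℕ) (I : Fin n × Fin d → Fin d) (v : ℕ) :
    Multiset (Fin d) :=
  (Finset.univ.filter fun e => h e = v).val.map I

/-- The product of the Levi-Civita symbols of all copies. -/
noncomputable def leviProd (I : Fin n × Fin d → Fin d) : ℝ :=
  ∏ b, leviCivita fun s => I (b, s)

/-- The contraction of the Levi-Civita symbols along the edges with heads `h`, where the vertex `v`
with incoming indices `s` contributes `J (codeClass v) s`. -/
noncomputable def amplitude (N : ℕ) (J : ℕ → Multiset (Fin d) → ℝ) (h : Fin n × Fin d → ℕ) : ℝ :=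
  ∑ I : Fin n × Fin d → Fin d,
    leviProd I * ∏ v ∈ Finset.range N, J (codeClass v) (incomingIndices h I v)

variable (N : ℕ) (J : ℕ → Multiset (Fin d) → ℝ) (h : Fin n × Fin d → ℕ)

theorem incomingIndices_comp (I : Fin n × Fin d → Fin d) (e : Equiv.Perm (Fin n × Fin d))
    (v : ℕ) : incomingIndices (h ∘ e) (I ∘ e) v = incomingIndices h I v := by
  unfold incomingIndices
  have : (Finset.univ.filter fun x => h x = v) =
      (Finset.univ.filter fun x => (h ∘ e) x = v).map e.toEmbedding := by
    ext x
    simp only [Finset.mem_filter, Finset.mem_univ, true_and, Finset.mem_map,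
      Equiv.coe_toEmbedding, Function.comp_apply]
    exact ⟨fun hx => ⟨e.symm x, by simpa using hx, by simp⟩, by rintro ⟨y, hy, rfl⟩; exact hy⟩
  rw [this, Finset.map_val, Multiset.map_map]
  rfl

/-- A change of the summation variable moves a permutation of edges from the heads to the
Levi-Civita symbols. All identities between amplitudes with permuted edges follow from identities
for `leviProd`. -/
theorem amplitude_comp (e : Equiv.Perm (Fin n × Fin d)) :
    amplitude N J (h ∘ e) = ∑ I : Fin n × Fin d → Fin d,
      leviProd (I ∘ e) * ∏ v ∈ Finset.range N, J (codeClass v) (incomingIndices h I v) := by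
  unfold amplitude
  rw [← Equiv.sum_comp (e.symm.arrowCongr (Equiv.refl (Fin d)))]
  refine Finset.sum_congr rfl fun I _ => ?_
  have : (e.symm.arrowCongr (Equiv.refl (Fin d))) I = I ∘ e := by
    ext x; simp [Equiv.arrowCongr]
  simp only [this, incomingIndices_comp]

/-- Vertices of one class carry the same content, so such a relabelling only reindexes the product
over vertices. -/
theorem amplitude_relabel (w : Equiv.Perm ℕ) (hw : ∀ v, codeClass (w v) = codeClass v)
    (hN : ∀ v, v < N → w v < N) : amplitude N J (w ∘ h) = amplitude N J h := by
  unfold amplitude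
  refine Finset.sum_congr rfl fun I _ => congrArg _ ?_
  symm
  refine Finset.prod_bij (fun v _ => w v) (fun v hv => ?_) (fun _ _ _ _ hab => w.injective hab)
    ?_ (fun v _ => ?_)
  · exact Finset.mem_range.2 (hN v (Finset.mem_range.1 hv))
  · have := Finset.surj_on_of_inj_on_of_card_le (s := Finset.range N) (t := Finset.range N)
      (fun v _ => w v) (fun v hv => Finset.mem_range.2 (hN v (Finset.mem_range.1 hv)))
      (fun _ _ _ _ hab => w.injective hab) le_rfl
    intro b hb
    obtain ⟨a, ha, rfl⟩ := this b hb
    exact ⟨a, ha, rfl⟩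
  · simp [hw, incomingIndices]

theorem amplitude_copies (σ : Equiv.Perm (Fin n)) :
    amplitude N J (fun e => h (σ e.1, e.2)) = amplitude N J h := by
  have : (fun e => h (σ e.1, e.2)) = h ∘ (Equiv.prodCongr σ (Equiv.refl (Fin d))) := rfl
  rw [this, amplitude_comp, amplitude]
  refine Finset.sum_congr rfl fun I _ => congrArg (· * _) ?_
  exact Equiv.prod_comp σ fun b => leviCivita fun s => I (b, s)

theorem amplitude_slots_perm (τ : Fin n → Equiv.Perm (Fin d)) :
    amplitude N J (fun e => h (e.1, τ e.1 e.2)) =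
      (∏ b, leviCivita (τ b)) * amplitude N J h := by
  have : (fun e => h (e.1, τ e.1 e.2)) = h ∘ (Equiv.prodCongrRight τ) := rfl
  rw [this, amplitude_comp, amplitude, Finset.mul_sum]
  refine Finset.sum_congr rfl fun I _ => ?_
  rw [← mul_assoc, leviProd, leviProd, ← Finset.prod_mul_distrib]
  congr 1
  refine Finset.prod_congr rfl fun b _ => ?_
  rw [leviCivita_of_perm, ← leviCivita_comp_perm]
  rfl

/-- The transposition of the two edges preserves the heads and reverses the sign. -/
theorem amplitude_eq_zero_of_repeated {b : Fin n} {s t : Fin d} (hst : s ≠ t)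
    (hh : h (b, s) = h (b, t)) : amplitude N J h = 0 := by
  have key := amplitude_slots_perm N J h (Function.update 1 b (Equiv.swap s t))
  have h1 : (fun e : Fin n × Fin d =>
      h (e.1, (Function.update 1 b (Equiv.swap s t) : Fin n → Equiv.Perm (Fin d)) e.1 e.2)) = h := by
    ext ⟨c, u⟩
    by_cases hc : c = b
    · subst hc
      simp only [Function.update_self]
      rcases eq_or_ne u s with rfl | hs
      · simp [hh]
      · rcases eq_or_ne u t with rfl | ht
        · simp [hh]
        · rw [Equiv.swap_apply_of_ne_of_ne hs ht]
    · simp [hc]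
  have h2 : (∏ c, leviCivita
      ((Function.update 1 b (Equiv.swap s t) : Fin n → Equiv.Perm (Fin d)) c)) = -1 := by
    rw [Finset.prod_eq_single b]
    · simp [leviCivita_of_perm, Equiv.Perm.sign_swap hst]
    · intro c _ hc
      rw [Function.update_of_ne hc, leviCivita_of_perm]
      simp
    · simp
  rw [h1, h2] at key
  linarith

/-- Maps `g b` that are not injective are allowed: both sides are then zero, by a repeated head on
the left and by the symbol of `g b` on the right. Hence repeated heads need no separate treatment in
the search. -/
theorem amplitude_slots (g : Fin n → Fin d → Fin d) :
    amplitude N J (fun e => h (e.1, g e.1 e.2)) = (∏ b, leviCivita (g b)) * amplitude N J h := by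
  by_cases hg : ∀ b, Function.Injective (g b)
  · have := amplitude_slots_perm N J h fun b =>
      Equiv.ofBijective (g b) (Finite.injective_iff_bijective.1 (hg b))
    simpa using this
  · push Not at hg
    obtain ⟨b, hb⟩ := hg
    rw [Finset.prod_eq_zero (Finset.mem_univ b) (leviCivita_of_not_injective hb), zero_mul]
    rw [Function.not_injective_iff] at hb
    obtain ⟨s, t, hst, hne⟩ := hb
    exact amplitude_eq_zero_of_repeated N J _ (b := b) hne (by simp only [hst])

theorem leviProd_exchange (I : Fin n × Fin d → Fin d) {b b' : Fin n} (hb : b ≠ b') (a : Fin d) :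
    leviProd I = ∑ s, leviProd (I ∘ Equiv.swap (b, a) (b', s)) := by
  have split : ∀ I : Fin n × Fin d → Fin d, leviProd I =
      (leviCivita (fun s => I (b, s)) * leviCivita (fun s => I (b', s))) *
        ∏ c ∈ (Finset.univ.erase b).erase b', leviCivita fun s => I (c, s) := by
    intro I
    rw [leviProd, ← Finset.mul_prod_erase _ _ (Finset.mem_univ b),
      ← Finset.mul_prod_erase _ _ (Finset.mem_erase.2 ⟨hb.symm, Finset.mem_univ b'⟩), mul_assoc]
  rw [split I, leviCivita_exchange _ _ a, Finset.sum_mul]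
  refine Finset.sum_congr rfl fun s _ => ?_
  rw [split (I ∘ _)]
  congr 1
  · congr 1
    · congr 1
      ext u
      by_cases hu : u = a
      · subst hu; simp
      · rw [Function.update_of_ne hu, Function.comp_apply, Equiv.swap_apply_of_ne_of_ne]
        · simp [hu]
        · simp [hb]
    · congr 1
      ext u
      by_cases hu : u = s
      · subst hu; simp
      · rw [Function.update_of_ne hu, Function.comp_apply, Equiv.swap_apply_of_ne_of_ne]
        · simp [hb.symm]
        · simp [hu]
  · refine Finset.prod_congr rfl fun c hc => ?_
    simp only [Finset.mem_erase, Finset.mem_univ, and_true] at hc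
    congr 1
    ext u
    rw [Function.comp_apply, Equiv.swap_apply_of_ne_of_ne] <;> simp [hc.1, hc.2]

/-- The Plücker relation for amplitudes: the head of one edge of the copy `b` is exchanged in turn
with the heads of all edges of the copy `b'`. -/
theorem amplitude_exchange {b b' : Fin n} (hb : b ≠ b') (a : Fin d) :
    amplitude N J h = ∑ s, amplitude N J (h ∘ Equiv.swap (b, a) (b', s)) := by
  simp only [amplitude_comp]
  rw [Finset.sum_comm, amplitude]
  refine Finset.sum_congr rfl fun I _ => ?_
  rw [← Finset.sum_mul, ← leviProd_exchange I hb]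

end Amplitude

/-! ### Computable signs of lists. -/

/-- The right fold, in terms of the recursor: this is fast for evaluation in the kernel. -/
def fold {α β : Type} (f : α → β → β) (z : β) (l : List α) : β :=
  List.rec z (fun a _ t => f a t) l

@[simp] theorem fold_nil {α β : Type} (f : α → β → β) (z : β) : fold f z [] = z := rfl

@[simp] theorem fold_cons {α β : Type} (f : α → β → β) (z : β) (a : α) (l : List α) :
    fold f z (a :: l) = f a (fold f z l) := rfl

/-- The sign of the comparison of the entries in a list, zero for a list with repetitions. -/
def levi (l : List ℕ) : ℤ :=
  List.rec 1 (fun a l t =>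
    fold (fun b t => bif Nat.blt a b then t else bif Nat.blt b a then Int.neg t else 0) t l) l

/-- The sign of `b - a`. -/
def compareSign (a b : ℕ) : ℤ := if a < b then 1 else if b < a then -1 else 0

theorem levi_cons (a : ℕ) (l : List ℕ) :
    levi (a :: l) = (l.map (compareSign a)).prod * levi l := by
  have : ∀ (l : List ℕ) (t : ℤ), fold (fun b t =>
      bif Nat.blt a b then t else bif Nat.blt b a then Int.neg t else 0) t l =
      (l.map (compareSign a)).prod * t := by
    intro l t
    induction l with
    | nil => simp
    | cons b l ih =>
      rw [fold_cons, ih, List.map_cons, List.prod_cons]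
      simp only [compareSign, Bool.cond_eq_ite, Nat.blt_eq]
      split_ifs
      · ring
      · change -_ = _
        ring
      · ring
  exact this l (levi l)

theorem levi_ofFn {d : ℕ} (f : Fin d → ℕ) :
    levi (List.ofFn f) = ∏ i, ∏ j ∈ Finset.Ioi i, compareSign (f i) (f j) := by
  induction d with
  | zero => rfl
  | succ d ih =>
    rw [List.ofFn_succ, levi_cons, ih, Fin.prod_univ_succ, Fin.prod_Ioi_zero]
    simp only [Fin.prod_Ioi_succ]
    rw [List.map_ofFn, List.prod_ofFn]
    rfl

theorem leviCivita_eq_levi_ofFn {d : ℕ} (m : ℕ) (i : Fin d → Fin d) :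
    leviCivita i = levi (List.ofFn fun s => m + (i s : ℕ)) := by
  rw [levi_ofFn]
  by_cases hi : Function.Injective i
  · have hσ : i = Equiv.ofBijective i (Finite.injective_iff_bijective.1 hi) := rfl
    conv_lhs => rw [hσ]
    rw [leviCivita_of_perm, Equiv.Perm.sign_eq_prod_prod_Ioi, Units.coe_prod]
    congr 1
    refine Finset.prod_congr rfl fun a _ => ?_
    rw [Units.coe_prod]
    refine Finset.prod_congr rfl fun b hb => ?_
    have hne : i a ≠ i b := fun h => (Finset.mem_Ioi.1 hb).ne (hi h)
    have hne' : (i a : ℕ) ≠ i b := fun h => hne (Fin.ext h)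
    simp only [Equiv.ofBijective_apply, compareSign, Fin.lt_def, add_lt_add_iff_left]
    split_ifs <;> first | rfl | omega
  · rw [leviCivita_of_not_injective hi]
    simp only [Function.Injective, not_forall] at hi
    obtain ⟨a, b, hab, hne⟩ := hi
    wlog hlt : a < b generalizing a b
    · exact this b a hab.symm (Ne.symm hne) (lt_of_le_of_ne (not_lt.1 hlt) (Ne.symm hne))
    rw [Finset.prod_eq_zero (Finset.mem_univ a)]
    · simp
    · exact Finset.prod_eq_zero (Finset.mem_Ioi.2 hlt) (by simp [compareSign, hab])

/-- Only comparisons of entries matter, so a common offset `m` is harmless. It is 0 for positions in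
a row and 10 for coordinates coded as `10 + i`. -/
theorem leviCivita_eq_levi {d : ℕ} (m : ℕ) (i : Fin d → Fin d) (l : List ℕ) (hl : l.length = d)
    (h : ∀ s : Fin d, l.getD s 0 = m + i s) : leviCivita i = levi l := by
  rw [leviCivita_eq_levi_ofFn m]
  congr 2
  refine List.ext_getElem (by simp [hl]) fun s h1 h2 => ?_
  have := h ⟨s, by simpa using h1⟩
  simp only [List.getD_eq_getElem?_getD, List.getElem?_eq_getElem h2, Option.getD_some] at this
  simp [this]

/-! ### Strict evaluation of arguments in the kernel. -/

section ForcedEvaluation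

/-- Membership in a list. -/
def memNat (v : ℕ) (l : List ℕ) : Bool := fold (fun a t => or (Nat.beq v a) t) false l

/-- Application `f n`, which evaluates the argument `n` first. -/
def force {α : Type} (n : ℕ) (f : ℕ → α) : α :=
  Nat.rec (f 0) (fun m _ => f (Nat.succ m)) n

/-- Application of a function to `l.map f`, which evaluates the argument first. -/
def mapForce {α : Type} (f : ℕ → ℕ) (l : List ℕ) : (List ℕ → α) → α :=
  fold (fun a t k => force (f a) fun b => t fun l' => k (b :: l')) (fun k => k []) l

/-- Application of a function to a table, which evaluates the table first. -/
def tableForce {α : Type} (rows : List (List ℕ)) : (List (List ℕ) → α) → α :=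
  fold (fun r t k => mapForce id r fun r' => t fun rs' => k (r' :: rs')) (fun k => k []) rows

theorem memNat_iff (v : ℕ) (l : List ℕ) : memNat v l = true ↔ v ∈ l := by
  unfold memNat
  induction l with
  | nil => simp
  | cons a l ih => rw [fold_cons, Bool.or_eq_true, ih, List.mem_cons, Nat.beq_eq]

theorem force_eq {α : Type} (n : ℕ) (f : ℕ → α) : force n f = f n := by
  cases n <;> rfl

theorem mapForce_eq {α : Type} (f : ℕ → ℕ) (l : List ℕ) (k : List ℕ → α) :
    mapForce f l k = k (l.map f) := by
  unfold mapForce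
  induction l generalizing k with
  | nil => rfl
  | cons a l ih => rw [fold_cons, force_eq, ih, List.map_cons]

theorem tableForce_eq {α : Type} (rows : List (List ℕ)) (k : List (List ℕ) → α) :
    tableForce rows k = k rows := by
  unfold tableForce
  induction rows generalizing k with
  | nil => rfl
  | cons r rows ih => rw [fold_cons, mapForce_eq, ih, List.map_id]

end ForcedEvaluation

/-- The heads of the edges listed in three rows, one for each copy. -/
def heads (d : ℕ) (rows : List (List ℕ)) (e : Fin 3 × Fin d) : ℕ :=
  (rows.getD e.1 []).getD e.2 0

/-- There are three rows with `d` entries each. -/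
def IsTable (d : ℕ) (rows : List (List ℕ)) : Prop :=
  rows.length = 3 ∧ ∀ r ∈ rows, r.length = d

theorem IsTable.eq_three {d : ℕ} {rows : List (List ℕ)} (h : IsTable d rows) :
    ∃ r₀ r₁ r₂, rows = [r₀, r₁, r₂] ∧ r₀.length = d ∧ r₁.length = d ∧ r₂.length = d := by
  obtain ⟨h1, h2⟩ := h
  obtain ⟨r₀, r₁, r₂, rfl⟩ := List.length_eq_three.1 h1
  exact ⟨r₀, r₁, r₂, rfl, h2 _ (by simp), h2 _ (by simp), h2 _ (by simp)⟩

theorem isTable_three {d : ℕ} {r₀ r₁ r₂ : List ℕ} (h₀ : r₀.length = d) (h₁ : r₁.length = d)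
    (h₂ : r₂.length = d) : IsTable d [r₀, r₁, r₂] := by
  refine ⟨rfl, fun r hr => ?_⟩
  simp only [List.mem_cons, List.not_mem_nil, or_false] at hr
  rcases hr with rfl | rfl | rfl <;> assumption

theorem IsTable.map {d : ℕ} {rows : List (List ℕ)} (h : IsTable d rows) (f : ℕ → ℕ) :
    IsTable d (rows.map (List.map f)) := by
  obtain ⟨r₀, r₁, r₂, rfl, h₀, h₁, h₂⟩ := h.eq_three
  exact isTable_three (by simpa) (by simpa) (by simpa)

theorem heads_map {d : ℕ} {rows : List (List ℕ)} (h : IsTable d rows) (f : ℕ → ℕ) :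
    heads d (rows.map (List.map f)) = f ∘ heads d rows := by
  obtain ⟨r₀, r₁, r₂, rfl, h₀, h₁, h₂⟩ := h.eq_three
  ext ⟨b, s⟩
  fin_cases b <;> simp [heads, *]

/-! ### Search for certificates of vanishing, and its soundness. -/

section Relations

/-- The place of the first occurrence. -/
def position (v : ℕ) (l : List ℕ) : ℕ := fold (fun a t => bif Nat.beq a v then 0 else Nat.succ t) 0 l

theorem position_eq_idxOf (v : ℕ) (l : List ℕ) : position v l = l.idxOf v := by
  unfold position
  induction l with
  | nil => rfl
  | cons a l ih =>
    rw [fold_cons, ih, List.idxOf_cons, Bool.cond_eq_ite, Bool.cond_eq_ite]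
    simp only [Nat.beq_eq, beq_iff_eq, Nat.succ_eq_add_one]

/-- The sign which relates two tables whose rows differ by the order of entries. -/
def rowsSign : List (List ℕ) → List (List ℕ) → Option ℤ
  | [], [] => some 1
  | r :: rs, r' :: rs' =>
    bif fold (fun v t => and (memNat v r) t) true r' then
      (rowsSign rs rs').map fun z => mapForce (fun v => position v r) r' levi * z
    else none
  | _, _ => none

/-- Interchange of the last two copies. -/
def swapLast : List (List ℕ) → List (List ℕ)
  | [r₀, r₁, r₂] => [r₀, r₂, r₁]
  | rows => rows

/-- The transposition of `a` and `b`. -/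
def swapCode (a b v : ℕ) : ℕ := bif Nat.beq v a then b else bif Nat.beq v b then a else v

/-- Tables with the same amplitude, obtained by at most one transposition of vertices in each of
the first `m` classes and by an interchange of copies. -/
def symmetricTables : ℕ → List (List ℕ) → List (List (List ℕ))
  | 0, rows => [rows, swapLast rows]
  | m + 1, rows => symmetricTables m rows ++
    [(3 * m + 1, 3 * m + 2), (3 * m + 1, 3 * m + 3), (3 * m + 2, 3 * m + 3)].flatMap fun p =>
      tableForce (rows.map (List.map (swapCode p.1 p.2))) (symmetricTables m)

/-- Factors by which the amplitude of `rows'` differs from the one of `rows`. -/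
def relations (m : ℕ) (rows rows' : List (List ℕ)) : List ℤ :=
  (symmetricTables m rows).filterMap fun t => rowsSign t rows'

/-- The entry in the given place. -/
def entry (rows : List (List ℕ)) (b s : ℕ) : ℕ := (rows.getD b []).getD s 0

/-- Replace the entry in the given place. -/
def setEntry (rows : List (List ℕ)) (b s v : ℕ) : List (List ℕ) :=
  rows.set b ((rows.getD b []).set s v)

/-- Exchange the entries in two places. -/
def exchange (rows : List (List ℕ)) (b s b' s' : ℕ) : List (List ℕ) :=
  setEntry (setEntry rows b s (entry rows b' s')) b' s' (entry rows b s)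

/-- The sum of coefficients, if all of them are known. -/
def sumKnown : List (Option ℤ) → Option ℤ
  | [] => some 0
  | some z :: l => (sumKnown l).map (z + ·)
  | none :: _ => none

/-- A search for a proof that the amplitude of a table vanishes: either the table has a symmetry
which multiplies the amplitude by a factor different from `1`, or there is a Plücker relation in
which every term is known to be zero or a multiple of the given amplitude. -/
def provablyZero (m : ℕ) : ℕ → List (List ℕ) → Bool
  | 0, rows => (relations m rows rows).any fun z => decide (z ≠ 1)
  | n + 1, rows => provablyZero m n rows ||
      (List.range m).any fun a => [1, 2].any fun b =>
        match sumKnown ((List.range (m + 1)).map fun s =>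
          bif provablyZero m n (exchange rows 0 (a + 1) b s) then some 0
          else (relations m rows (exchange rows 0 (a + 1) b s)).head?) with
        | some z => decide (z ≠ 1)
        | none => false

variable {m : ℕ} (J : ℕ → Multiset (Fin (m + 1)) → ℝ)

theorem swapCode_eq (a b : ℕ) : swapCode a b = Equiv.swap a b := by
  ext v
  rw [swapCode, Equiv.swap_apply_def, Bool.cond_eq_ite, Bool.cond_eq_ite]
  simp only [Nat.beq_eq]

theorem symmetricTables_spec (k : ℕ) (hk : k ≤ m) {rows t : List (List ℕ)}
    (h : IsTable (m + 1) rows) (ht : t ∈ symmetricTables k rows) : IsTable (m + 1) t ∧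
      amplitude (3 * m + 1) J (heads (m + 1) t) =
        amplitude (3 * m + 1) J (heads (m + 1) rows) := by
  induction k generalizing rows with
  | zero =>
    simp only [symmetricTables, List.mem_cons, List.not_mem_nil, or_false] at ht
    rcases ht with rfl | rfl
    · exact ⟨h, rfl⟩
    · obtain ⟨r₀, r₁, r₂, rfl, h₀, h₁, h₂⟩ := h.eq_three
      refine ⟨isTable_three h₀ h₂ h₁, ?_⟩
      rw [← amplitude_copies _ J (heads (m + 1) [r₀, r₁, r₂]) (Equiv.swap 1 2)]
      congr 1
      ext ⟨b, s⟩
      fin_cases b <;> rfl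
  | succ k ih =>
    have key : ∀ i j, codeClass i = codeClass j → i < 3 * m + 1 → j < 3 * m + 1 →
        t ∈ symmetricTables k (rows.map (List.map (swapCode i j))) → IsTable (m + 1) t ∧
          amplitude (3 * m + 1) J (heads (m + 1) t) =
            amplitude (3 * m + 1) J (heads (m + 1) rows) := by
      intro i j hij hi hj ht
      obtain ⟨h1, h2⟩ := ih (by omega) (h.map _) ht
      refine ⟨h1, h2.trans ?_⟩
      rw [heads_map h, swapCode_eq]
      refine amplitude_relabel _ J _ _ (fun v => ?_) fun v hv => ?_
      all_goals
        rw [Equiv.swap_apply_def]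
        split_ifs with h h
      · rw [h, hij]
      · rw [h, hij]
      · rfl
      · exact hj
      · exact hi
      · exact hv
    simp only [symmetricTables, tableForce_eq, List.mem_append, List.mem_flatMap, List.mem_cons,
      List.not_mem_nil, or_false, exists_eq_or_imp, exists_eq_left] at ht
    rcases ht with ht | ht | ht | ht
    · exact ih (by omega) h ht
    all_goals exact key _ _ (by unfold codeClass; omega) (by omega) (by omega) ht

/-- Each entry of a row of `rows'` is sent to its first occurrence in the corresponding row of
`rows`; the factor is the product of the signs of these three maps. A repeated entry in a row of
`rows'` gives the factor 0, which is correct by `amplitude_slots`. -/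
theorem rowsSign_spec {rows rows' : List (List ℕ)} (h : IsTable (m + 1) rows)
    (h' : IsTable (m + 1) rows') {z : ℤ} (hz : rowsSign rows rows' = some z) :
    amplitude (3 * m + 1) J (heads (m + 1) rows') =
      z * amplitude (3 * m + 1) J (heads (m + 1) rows) := by
  have row : ∀ r r' : List ℕ, r.length = m + 1 → r'.length = m + 1 → (∀ v ∈ r', v ∈ r) →
      ∃ g : Fin (m + 1) → Fin (m + 1), (∀ s : Fin (m + 1), r'.getD s 0 = r.getD (g s) 0) ∧
        leviCivita g = levi (r'.map fun v => r.idxOf v) := by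
    intro r r' hr hr' hmem
    have hlt : ∀ s : Fin (m + 1), (s : ℕ) < r'.length := fun s => by rw [hr']; exact s.2
    have hidx : ∀ s : Fin (m + 1), r.idxOf (r'[(s : ℕ)]'(hlt s)) < m + 1 := fun s => by
      exact (List.idxOf_lt_length_of_mem (hmem _ (List.getElem_mem _))).trans_eq hr
    refine ⟨fun s => ⟨_, hidx s⟩, fun s => ?_, ?_⟩
    · rw [List.getD_eq_getElem _ _ (hlt s), List.getD_eq_getElem _ _ (by simpa [hr] using hidx s)]
      simp
    · refine leviCivita_eq_levi 0 _ _ (by simpa using hr') fun s => ?_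
      rw [List.getD_eq_getElem _ _ (by simpa using hlt s)]
      simp
  obtain ⟨r₀, r₁, r₂, rfl, h₀, h₁, h₂⟩ := h.eq_three
  obtain ⟨r₀', r₁', r₂', rfl, h₀', h₁', h₂'⟩ := h'.eq_three
  have hall : ∀ r r' : List ℕ, fold (fun v t => and (memNat v r) t) true r' = true ↔
      ∀ v ∈ r', v ∈ r := by
    intro r r'
    induction r' with
    | nil => simp
    | cons v r' ih => rw [fold_cons, Bool.and_eq_true, memNat_iff, ih]; simp
  simp only [rowsSign, Bool.cond_eq_ite, hall, mapForce_eq, position_eq_idxOf] at hz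
  split_ifs at hz with m₀ m₁ m₂
  · simp only [Option.map_some, Option.some.injEq] at hz
    obtain ⟨g₀, hg₀, hl₀⟩ := row r₀ r₀' h₀ h₀' m₀
    obtain ⟨g₁, hg₁, hl₁⟩ := row r₁ r₁' h₁ h₁' m₁
    obtain ⟨g₂, hg₂, hl₂⟩ := row r₂ r₂' h₂ h₂' m₂
    have := amplitude_slots (3 * m + 1) J (heads (m + 1) [r₀, r₁, r₂]) ![g₀, g₁, g₂]
    rw [Fin.prod_univ_three] at this
    simp only [Matrix.cons_val_zero, Matrix.cons_val_one, Matrix.cons_val_two, Matrix.head_cons,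
      Matrix.tail_cons, hl₀, hl₁, hl₂] at this
    rw [← hz]
    push_cast
    rw [mul_one, ← mul_assoc, ← this]
    congr 1
    ext ⟨b, s⟩
    fin_cases b
    · simpa [heads] using hg₀ s
    · simpa [heads] using hg₁ s
    · simpa [heads] using hg₂ s
  all_goals simp at hz

theorem relations_spec {rows rows' : List (List ℕ)} (h : IsTable (m + 1) rows)
    (h' : IsTable (m + 1) rows') {z : ℤ} (hz : z ∈ relations m rows rows') :
    amplitude (3 * m + 1) J (heads (m + 1) rows') =
      z * amplitude (3 * m + 1) J (heads (m + 1) rows) := by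
  simp only [relations, List.mem_filterMap] at hz
  obtain ⟨t, ht, hz⟩ := hz
  obtain ⟨h1, h2⟩ := symmetricTables_spec J m le_rfl h ht
  rw [rowsSign_spec J h1 h' hz, h2]

theorem IsTable.setEntry {d : ℕ} {rows : List (List ℕ)} (h : IsTable d rows) (b : Fin 3)
    (s : Fin d) (v : ℕ) : IsTable d (setEntry rows b s v) ∧
      heads d (setEntry rows b s v) = Function.update (heads d rows) (b, s) v := by
  obtain ⟨r₀, r₁, r₂, rfl, h₀, h₁, h₂⟩ := h.eq_three
  have key : ∀ r : List ℕ, r.length = d → ∀ t : Fin d,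
      (r.set s v).getD t 0 = if t = s then v else r.getD t 0 := by
    intro r hr t
    simp only [List.getD_eq_getElem?_getD, List.getElem?_set, hr, s.2, if_true, Fin.ext_iff]
    split_ifs with h1 h2 h2
    · rfl
    · omega
    · omega
    · rfl
  constructor
  · fin_cases b
    · exact isTable_three (by simpa using h₀) h₁ h₂
    · exact isTable_three h₀ (by simpa using h₁) h₂
    · exact isTable_three h₀ h₁ (by simpa using h₂)
  · ext ⟨c, t⟩
    rw [Function.update_apply]
    have := key _ h₀ t
    have := key _ h₁ t
    have := key _ h₂ t
    fin_cases b <;> fin_cases c <;> simp_all [NambuMicro.setEntry, heads]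

theorem IsTable.exchange {d : ℕ} {rows : List (List ℕ)} (h : IsTable d rows) (b b' : Fin 3)
    (s s' : Fin d) : IsTable d (exchange rows b s b' s') ∧
      heads d (exchange rows b s b' s') = heads d rows ∘ Equiv.swap (b, s) (b', s') := by
  obtain ⟨h1, h2⟩ := h.setEntry b s (entry rows b' s')
  obtain ⟨h3, h4⟩ := h1.setEntry b' s' (entry rows b s)
  refine ⟨h3, ?_⟩
  unfold NambuMicro.exchange
  rw [h4, h2, Equiv.swap_comm, Equiv.comp_swap_eq_update]
  rfl

theorem sumKnown_spec {ι : Type} (l : List ι) (f : ι → Option ℤ) (F : ι → ℝ) (A : ℝ)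
    (hf : ∀ i ∈ l, ∀ z, f i = some z → F i = z * A) {z : ℤ} (hz : sumKnown (l.map f) = some z) :
    (l.map F).sum = z * A := by
  induction l generalizing z with
  | nil =>
    simp only [List.map_nil, sumKnown, Option.some.injEq] at hz
    simp [← hz]
  | cons i l ih =>
    rw [List.map_cons] at hz
    cases hi : f i with
    | none => simp [hi, sumKnown] at hz
    | some y =>
      rw [hi] at hz
      simp only [sumKnown, Option.map_eq_some_iff] at hz
      obtain ⟨x, hx, rfl⟩ := hz
      rw [List.map_cons, List.sum_cons, hf i (by simp) y hi,
        ih (fun j hj => hf j (by simp [hj])) hx]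
      push_cast
      ring

/-- Both kinds of certificate have the form A = z * A with z ≠ 1. In the Plücker case z is the sum
of the factors of the exchanged tables, where a table already proved to vanish at a smaller depth
counts as zero. -/
theorem amplitude_eq_zero_of_provablyZero (n : ℕ) {rows : List (List ℕ)}
    (h : IsTable (m + 1) rows) (hz : provablyZero m n rows = true) :
    amplitude (3 * m + 1) J (heads (m + 1) rows) = 0 := by
  have cancel : ∀ {z : ℤ} {A : ℝ}, A = z * A → z ≠ 1 → A = 0 := by
    intro z A hA hz
    have : ((z : ℝ) - 1) * A = 0 := by linear_combination -hA
    rcases mul_eq_zero.1 this with h | h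
    · exact absurd (by exact_mod_cast sub_eq_zero.1 h) hz
    · exact h
  induction n generalizing rows with
  | zero =>
    simp only [provablyZero, List.any_eq_true, decide_eq_true_eq] at hz
    obtain ⟨z, hz, hne⟩ := hz
    exact cancel (relations_spec J h h hz) hne
  | succ n ih =>
    rw [provablyZero, Bool.or_eq_true] at hz
    rcases hz with hz | hz
    · exact ih h hz
    simp only [List.any_eq_true, List.mem_range] at hz
    obtain ⟨a, ha, b, hb, hz⟩ := hz
    obtain ⟨b', rfl, hb'⟩ : ∃ b' : Fin 3, (b' : ℕ) = b ∧ (0 : Fin 3) ≠ b' := by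
      simp only [List.mem_cons, List.not_mem_nil, or_false] at hb
      rcases hb with rfl | rfl
      · exact ⟨1, rfl, by decide⟩
      · exact ⟨2, rfl, by decide⟩
    split at hz
    · rename_i z hs
      rw [decide_eq_true_eq] at hz
      refine cancel ?_ hz
      -- The shift `a + 1` leaves edge 0 of the first copy, the one into the sink for `keyRows`, out
      -- of all exchanges.
      have hx : ∀ s : Fin (m + 1), _ := fun s => h.exchange 0 b' ⟨a + 1, by omega⟩ s
      have := sumKnown_spec _ _ (fun s => amplitude (3 * m + 1) J
        (heads (m + 1) (exchange rows 0 (a + 1) b' s)))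
        (amplitude (3 * m + 1) J (heads (m + 1) rows)) ?_ hs
      · rw [← this, amplitude_exchange _ J _ hb' ⟨a + 1, by omega⟩]
        refine (Finset.sum_congr rfl fun s _ => ?_).trans (Finset.sum_range _).symm
        rw [← (hx s).2]
        rfl
      · intro s hs z hz
        have hs : IsTable (m + 1) (exchange rows 0 (a + 1) b' s) :=
          (hx ⟨s, List.mem_range.1 hs⟩).1
        rw [Bool.cond_eq_ite] at hz
        split_ifs at hz with h0
        · rw [Option.some.injEq] at hz
          rw [ih hs h0, ← hz]
          simp
        · exact relations_spec J h hs (List.mem_of_head? hz)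
    · simp at hz

end Relations

/-! ### Jets of smooth functions as functions of multisets of indices. -/

section Jets

variable {d : ℕ}

theorem contDiff_partialDeriv {g : (Fin d → ℝ) → ℝ} (hg : ContDiff ℝ ∞ g) (i : Fin d) :
    ContDiff ℝ ∞ (partialDeriv i g) := by
  unfold partialDeriv
  exact (hg.fderiv_right (m := ∞) (by simp)).clm_apply contDiff_const

theorem contDiff_iterPartial {g : (Fin d → ℝ) → ℝ} (hg : ContDiff ℝ ∞ g) (l : List (Fin d)) :
    ContDiff ℝ ∞ (iterPartial l g) := by
  induction l with
  | nil => exact hg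
  | cons i l ih => exact contDiff_partialDeriv ih i

theorem partialDeriv_comm {g : (Fin d → ℝ) → ℝ} (hg : ContDiff ℝ ∞ g) (i j : Fin d) :
    partialDeriv i (partialDeriv j g) = partialDeriv j (partialDeriv i g) := by
  have key : ∀ (i j : Fin d) (x : Fin d → ℝ), partialDeriv i (partialDeriv j g) x =
      fderiv ℝ (fderiv ℝ g) x (Pi.single i 1) (Pi.single j 1) := by
    intro i j x
    have hd : DifferentiableAt ℝ (fderiv ℝ g) x :=
      (hg.fderiv_right (m := ∞) (by simp)).differentiable (by simp) x
    unfold partialDeriv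
    rw [fderiv_clm_apply hd (differentiableAt_const _)]
    simp
  ext x
  rw [key, key]
  have : IsSymmSndFDerivAt ℝ g x := by
    refine ContDiffAt.isSymmSndFDerivAt hg.contDiffAt ?_
    rw [minSmoothness_of_isRCLikeNormedField]
    exact WithTop.coe_le_coe.2 (le_top (a := (2 : ℕ∞)))
  exact this _ _

/-- Symmetry of second derivatives, applied to adjacent transpositions. It allows the ordered list
of incoming edges to be replaced by a multiset. -/
theorem iterPartial_perm {g : (Fin d → ℝ) → ℝ} (hg : ContDiff ℝ ∞ g) {l l' : List (Fin d)}
    (h : l.Perm l') : iterPartial l g = iterPartial l' g := by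
  induction h with
  | nil => rfl
  | cons i _ ih => exact congrArg (partialDeriv i) ih
  | swap i j l => exact partialDeriv_comm (contDiff_iterPartial hg l) j i
  | trans _ _ ih₁ ih₂ => exact ih₁.trans ih₂

/-- The partial derivative at `x` along a multiset of coordinates. -/
noncomputable def jet (g : (Fin d → ℝ) → ℝ) (x : Fin d → ℝ) (s : Multiset (Fin d)) : ℝ :=
  iterPartial s.toList g x

theorem iterPartial_eq_jet {g : (Fin d → ℝ) → ℝ} (hg : ContDiff ℝ ∞ g) (x : Fin d → ℝ)
    (l : List (Fin d)) : iterPartial l g x = jet g x l := by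
  unfold jet
  rw [iterPartial_perm hg]
  exact Multiset.coe_eq_coe.1 (Multiset.coe_toList (l : Multiset (Fin d))).symm

end Jets

/-! ### Numbering of vertices, and the formula as an amplitude. -/

section Encoding

/-- The number of the vertex of the copy `b` in the class `x + 1`. -/
def targetCode (x b : ℕ) : ℕ := 1 + 3 * x + b

/-- The numbering of vertices. -/
def vertexCode {c : ℕ} : Vertex 1 3 c → ℕ
  | Vertex.sink _ => 0
  | Vertex.top b => targetCode 0 b
  | Vertex.casimir k b => targetCode (k + 1) b

theorem vertexCode_injective {c : ℕ} : Function.Injective (vertexCode (c := c)) := by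
  rintro (j | b | ⟨k, b⟩) (j' | b' | ⟨k', b'⟩) h <;> simp only [vertexCode, targetCode] at h
  · rw [Subsingleton.elim j j']
  · omega
  · omega
  · omega
  · congr 1; ext; omega
  · have := b.2; omega
  · omega
  · have := b'.2; omega
  · have := b.2
    have := b'.2
    have hk : k = k' := by ext; omega
    have hb : b = b' := by ext; omega
    rw [hk, hb]

theorem coe_incoming {c : ℕ} (G : MicroGraph 1 3 c) (h : Fin 3 × Fin (c + 2) → ℕ)
    (hh : ∀ b s, vertexCode (head G b s) = h (b, s)) (I : Fin 3 × Fin (c + 2) → Fin (c + 2))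
    (v : Vertex 1 3 c) :
    (incoming G (fun b s => I (b, s)) v : Multiset (Fin (c + 2))) =
      incomingIndices h I (vertexCode v) := by
  have : ∀ e : Fin 3 × Fin (c + 2), (h e = vertexCode v) = (head G e.1 e.2 = v) := fun e => by
    rw [← hh, vertexCode_injective.eq_iff]
  simp only [incomingIndices, this]
  rfl

theorem prod_range_three_mul_add_one (F : ℕ → ℝ) (m : ℕ) :
    ∏ v ∈ Finset.range (3 * m + 1), F v =
      F 0 * ∏ x ∈ Finset.range m, ∏ b : Fin 3, F (targetCode x b) := by
  induction m with
  | zero => simp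
  | succ m ih =>
    rw [Finset.prod_range_succ _ m, ← mul_assoc, ← ih, Fin.prod_univ_three,
      show 3 * (m + 1) + 1 = 3 * m + 1 + 1 + 1 + 1 by ring, Finset.prod_range_succ,
      Finset.prod_range_succ, Finset.prod_range_succ]
    simp only [targetCode, Fin.val_zero, Fin.val_one, Fin.val_two]
    rw [show 1 + 3 * m + 0 = 3 * m + 1 by ring, show 1 + 3 * m + 1 = 3 * m + 1 + 1 by ring,
      show 1 + 3 * m + 2 = 3 * m + 1 + 1 + 1 by ring]
    ring

theorem codeClass_targetCode (x : ℕ) (b : Fin 3) : codeClass (targetCode x b) = x + 1 := by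
  have := b.2
  unfold codeClass targetCode
  omega

/-- The jets `J` are left abstract so that the same identity serves arbitrary smooth contents and
the exponential test functions. -/
theorem formula_eq_amplitude {c : ℕ} (G : MicroGraph 1 3 c) (h : Fin 3 × Fin (c + 2) → ℕ)
    (hh : ∀ b s, vertexCode (head G b s) = h (b, s)) (ρ : (Fin (c + 2) → ℝ) → ℝ)
    (a : Fin c → (Fin (c + 2) → ℝ) → ℝ) (f : Fin 1 → (Fin (c + 2) → ℝ) → ℝ)
    (x : Fin (c + 2) → ℝ) (J : ℕ → Multiset (Fin (c + 2)) → ℝ)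
    (hf : ∀ l : List (Fin (c + 2)), iterPartial l (f 0) x = J 0 l)
    (hρ : ∀ l : List (Fin (c + 2)), iterPartial l ρ x = J 1 l)
    (ha : ∀ (k : Fin c) (l : List (Fin (c + 2))), iterPartial l (a k) x = J (k + 2) l) :
    formula G ρ a f x = amplitude (3 * (c + 1) + 1) J h := by
  unfold formula amplitude
  rw [← Equiv.sum_comp (Equiv.curry (Fin 3) (Fin (c + 2)) (Fin (c + 2)))]
  refine Finset.sum_congr rfl fun I _ => ?_
  rw [prod_range_three_mul_add_one, Finset.prod_range_succ', Finset.prod_range]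
  have hI : (Equiv.curry (Fin 3) (Fin (c + 2)) (Fin (c + 2))) I = fun b s => I (b, s) := rfl
  simp only [hI, Finset.univ_unique, Finset.prod_singleton,
    Fin.default_eq_zero, hf, hρ, ha, coe_incoming G h hh I, codeClass_targetCode, vertexCode,
    Finset.prod_mul_distrib, leviProd]
  have h0 : codeClass 0 = 0 := rfl
  rw [h0, zero_add]
  simp only [add_assoc, Nat.reduceAdd]
  ring

end Encoding

/-! ### Test functions: sums of exponentials of single coordinates. -/

section Exponentials

variable {d : ℕ}

/-- The sum of the exponential functions `exp (p.2 * x p.1)`. -/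
noncomputable def expSum (L : List (Fin d × ℤ)) (x : Fin d → ℝ) : ℝ :=
  (L.map fun p => Real.exp (p.2 * x p.1)).sum

theorem contDiff_expSum (L : List (Fin d × ℤ)) : ContDiff ℝ ∞ (expSum L) := by
  induction L with
  | nil => exact contDiff_const
  | cons p L ih =>
    have : ContDiff ℝ ∞ fun x : Fin d → ℝ => Real.exp (p.2 * x p.1) := by fun_prop
    exact this.add ih

/-- The factor contributed by a term `p` when it is differentiated along `i`. -/
def derivFactor (p : Fin d × ℤ) (i : Fin d) : ℤ := if i = p.1 then p.2 else 0

/-- A derivative multiplies a term by its exponent if it is taken along the term's own coordinate,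
and kills the term otherwise. -/
theorem iterPartial_expSum (L : List (Fin d × ℤ)) (l : List (Fin d)) :
    iterPartial l (expSum L) = fun x => (L.map fun p =>
      (((l.map (derivFactor p)).prod : ℤ) : ℝ) * Real.exp (p.2 * x p.1)).sum := by
  induction l with
  | nil => ext x; simp [iterPartial, expSum]
  | cons i l ih =>
    change partialDeriv i (iterPartial l (expSum L)) = _
    rw [ih]
    clear ih
    ext x
    suffices H : HasFDerivAt (fun x : Fin d → ℝ => (L.map fun p =>
        (((l.map (derivFactor p)).prod : ℤ) : ℝ) * Real.exp (p.2 * x p.1)).sum)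
        (L.map fun p => ((((l.map (derivFactor p)).prod : ℤ) : ℝ) *
          (Real.exp (p.2 * x p.1) * p.2)) • (ContinuousLinearMap.proj p.1 :
            (Fin d → ℝ) →L[ℝ] ℝ)).sum x by
      unfold partialDeriv
      rw [H.fderiv]
      clear H
      induction L with
      | nil => simp
      | cons p L ih =>
        simp only [List.map_cons, List.sum_cons, add_apply, ih]
        congr 1
        simp only [derivFactor, smul_apply, ContinuousLinearMap.proj_apply,
          List.prod_cons, smul_eq_mul, Pi.single_apply, eq_comm (a := p.1)]
        split_ifs
        · simp
          ring
        · simp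
    induction L with
    | nil => exact hasFDerivAt_const 0 x
    | cons p L ih =>
      simp only [List.map_cons, List.sum_cons]
      refine HasFDerivAt.add ?_ ih
      have h1 : HasFDerivAt (fun x : Fin d → ℝ => x p.1)
          (ContinuousLinearMap.proj p.1 : (Fin d → ℝ) →L[ℝ] ℝ) x := hasFDerivAt_apply p.1 x
      have h2 := ((h1.const_mul (p.2 : ℝ)).exp).const_mul (((l.map (derivFactor p)).prod : ℤ) : ℝ)
      exact h2.congr_fderiv (by rw [smul_smul, smul_smul, mul_assoc])

/-- The jet at zero of a sum of exponential functions. -/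
def expJet (L : List (Fin d × ℤ)) (s : Multiset (Fin d)) : ℤ :=
  (L.map fun p => (s.map (derivFactor p)).prod).sum

theorem iterPartial_expSum_zero (L : List (Fin d × ℤ)) (l : List (Fin d)) :
    iterPartial l (expSum L) 0 = expJet L l := by
  rw [iterPartial_expSum, expJet]
  simp only [Pi.zero_apply, mul_zero, Real.exp_zero, mul_one, Multiset.map_coe,
    Multiset.prod_coe]
  induction L with
  | nil => simp
  | cons p L ih => rw [List.map_cons, List.map_cons, List.sum_cons, List.sum_cons, Int.cast_add, ih]

end Exponentials

/-! ### Recursive evaluation of the formula on test functions. -/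

section Evaluation

/-- Replacement of `v` by `w`. -/
def substCode (v w u : ℕ) : ℕ := bif Nat.beq u v then w else u

/-- Application of a function to the table where `v` is replaced by `w`, which evaluates the
table first. -/
def substForce {α : Type} (v w : ℕ) (rows : List (List ℕ)) : (List (List ℕ) → α) → α :=
  fold (fun r t k => bif memNat v r then
      mapForce (substCode v w) r fun r' => t fun rs' => k (r' :: rs')
    else t fun rs' => k (r :: rs')) (fun k => k []) rows

/-- Both `v` and `w` occur in one row. -/
def conflict (v w : ℕ) (rows : List (List ℕ)) : Bool :=
  fold (fun r t => or (and (memNat v r) (memNat w r)) t) false rows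

/-- The product of `z` and a factor `s` for every occurrence of `v`. -/
def scaled (v : ℕ) (s z : ℤ) (rows : List (List ℕ)) : ℤ :=
  fold (fun r t => fold (fun u t => bif Nat.beq u v then Int.mul s t else t) t r) z rows

/-- The sum over all assignments of terms of the exponential sums `L` to the vertices in the list;
the entry `10 + i` stands for a vertex with a function of the coordinate `i`. -/
def expValue {d : ℕ} (L : ℕ → List (Fin d × ℤ)) (vs : List ℕ) : List (List ℕ) → ℤ :=
  fold (fun v F rows =>
    bif fold (fun r t => or (memNat v r) t) false rows then
      fold (fun p t => Int.add t (force (10 + p.1) fun w =>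
        bif conflict v w rows then 0 else scaled v p.2 (substForce v w rows F) rows))
        0 (L (codeClass v))
    else Int.mul (L (codeClass v)).length (F rows))
   (fun rows => fold (fun r t => Int.mul (levi r) t) 1 rows) vs

theorem substCode_eq (v w u : ℕ) : substCode v w u = if u = v then w else u := by
  rw [substCode, Bool.cond_eq_ite]
  simp only [Nat.beq_eq]

theorem substForce_eq {α : Type} (v w : ℕ) (rows : List (List ℕ)) (k : List (List ℕ) → α) :
    substForce v w rows k = k (rows.map (List.map (substCode v w))) := by
  unfold substForce
  induction rows generalizing k with
  | nil => rfl
  | cons r rows ih =>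
    rw [fold_cons, mapForce_eq, ih, ih, List.map_cons, Bool.cond_eq_ite]
    simp only [memNat_iff]
    split_ifs with h
    · rfl
    · congr 2
      symm
      refine (List.map_congr_left fun u hu => ?_).trans (List.map_id r)
      rw [substCode_eq, if_neg (by rintro rfl; exact h hu)]
      rfl

theorem conflict_iff (v w : ℕ) (rows : List (List ℕ)) :
    conflict v w rows = true ↔ ∃ r ∈ rows, v ∈ r ∧ w ∈ r := by
  unfold conflict
  induction rows with
  | nil => simp
  | cons r rows ih =>
    rw [fold_cons, Bool.or_eq_true, ih, Bool.and_eq_true, memNat_iff, memNat_iff]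
    simp

theorem scaled_eq (v : ℕ) (s z : ℤ) (rows : List (List ℕ)) :
    scaled v s z rows =
      (rows.map fun r => (r.map fun u => if u = v then s else 1).prod).prod * z := by
  unfold scaled
  have row : ∀ (r : List ℕ) (t : ℤ), fold (fun u t => bif Nat.beq u v then Int.mul s t else t) t r =
      (r.map fun u => if u = v then s else 1).prod * t := by
    intro r t
    induction r with
    | nil => simp
    | cons u r ih =>
      rw [fold_cons, ih, Bool.cond_eq_ite, List.map_cons, List.prod_cons]
      simp only [Nat.beq_eq]
      split_ifs
      · change s * _ = _
        ring
      · ring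
  induction rows with
  | nil => simp
  | cons r rows ih => rw [fold_cons, ih, row, List.map_cons, List.prod_cons, mul_assoc]

theorem expValue_nil {d : ℕ} (L : ℕ → List (Fin d × ℤ)) (rows : List (List ℕ)) :
    expValue L [] rows = (rows.map levi).prod := by
  unfold expValue
  rw [fold_nil]
  induction rows with
  | nil => rfl
  | cons r rows ih =>
    rw [fold_cons, ih]
    rfl

theorem expValue_cons {d : ℕ} (L : ℕ → List (Fin d × ℤ)) (v : ℕ) (vs : List ℕ)
    (rows : List (List ℕ)) : expValue L (v :: vs) rows =
      if ∃ r ∈ rows, v ∈ r then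
        ((L (codeClass v)).map fun p =>
          if ∃ r ∈ rows, v ∈ r ∧ 10 + (p.1 : ℕ) ∈ r then 0 else
            (rows.map fun r => (r.map fun u => if u = v then p.2 else 1).prod).prod *
              expValue L vs (rows.map (List.map (substCode v (10 + p.1))))).sum
      else (L (codeClass v)).length * expValue L vs rows := by
  have hmem : (fold (fun r t => or (memNat v r) t) false rows) = true ↔ ∃ r ∈ rows, v ∈ r := by
    induction rows with
    | nil => simp
    | cons r rows ih => rw [fold_cons, Bool.or_eq_true, ih, memNat_iff]; simp
  have hcons : expValue L (v :: vs) rows =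
      bif fold (fun r t => or (memNat v r) t) false rows then
        fold (fun p t => Int.add t (force (10 + p.1) fun w =>
          bif conflict v w rows then 0 else
            scaled v p.2 (substForce v w rows (expValue L vs)) rows)) 0 (L (codeClass v))
      else Int.mul (L (codeClass v)).length (expValue L vs rows) := rfl
  rw [hcons, Bool.cond_eq_ite]
  simp only [hmem]
  split_ifs
  · induction L (codeClass v) with
    | nil => rfl
    | cons p l ih =>
      rw [fold_cons, ih, List.map_cons, List.sum_cons, force_eq, substForce_eq, scaled_eq,
        Bool.cond_eq_ite]
      simp only [conflict_iff]
      exact add_comm _ _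
  · rfl

end Evaluation

/-! ### Correctness of the recursive evaluation. -/

section Contraction

variable {d : ℕ}

theorem leviProd_swap {n : ℕ} (I : Fin n × Fin d → Fin d) (b : Fin n) {s t : Fin d}
    (hst : s ≠ t) : leviProd (I ∘ Equiv.swap (b, s) (b, t)) = -leviProd I := by
  unfold leviProd
  rw [← Finset.mul_prod_erase _ _ (Finset.mem_univ b),
    ← Finset.mul_prod_erase _ (fun c => leviCivita fun s => I (c, s)) (Finset.mem_univ b),
    ← neg_mul]
  congr 1
  · have : (fun u => (I ∘ Equiv.swap (b, s) (b, t)) (b, u)) =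
        (fun u => I (b, u)) ∘ Equiv.swap s t := by
      ext u
      simp only [Function.comp_apply, Equiv.swap_apply_def, Prod.mk.injEq, true_and]
      split_ifs <;> rfl
    rw [this, leviCivita_comp_perm, Equiv.Perm.sign_swap hst]
    simp
  · refine Finset.prod_congr rfl fun c hc => ?_
    congr 1
    ext u
    rw [Function.comp_apply, Equiv.swap_apply_of_ne_of_ne] <;> simp [Finset.ne_of_mem_erase hc]

/-- The product of factors of the derivatives of a term `p` in the vertex `v`. -/
def vertexFactor (h I : Fin 3 × Fin d → ℕ) (v : ℕ) (i : ℕ) (z : ℤ) : ℤ :=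
  ∏ e, if h e = v then (if I e = i then z else 0) else 1

/-- This is one if every edge with head `10 + i` carries the index `i`, and zero otherwise. -/
def fixedFactor (h I : Fin 3 × Fin d → ℕ) : ℤ :=
  ∏ e, if 10 ≤ h e then (if I e + 10 = h e then 1 else 0) else 1

/-- The contraction where the vertices in the list contain exponential sums, and the entry `10 + i`
stands for a vertex with a function of the coordinate `i`. -/
noncomputable def contraction (L : ℕ → List (Fin d × ℤ)) (vs : List ℕ)
    (h : Fin 3 × Fin d → ℕ) : ℝ :=
  ∑ I : Fin 3 × Fin d → Fin d, leviProd I *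
    (((vs.map fun v => ((L (codeClass v)).map fun p =>
      vertexFactor h (fun e => I e) v p.1 p.2).sum).prod * fixedFactor h (fun e => I e) : ℤ) : ℝ)

variable (L : ℕ → List (Fin d × ℤ))

/-- Interchanging the two indices reverses the sign of `leviProd` and fixes every other factor. This
justifies cutting off the branches detected by `conflict`. -/
theorem contraction_eq_zero_of_repeated (vs : List ℕ) (h : Fin 3 × Fin d → ℕ) {b : Fin 3}
    {s t : Fin d} (hst : s ≠ t) (hh : h (b, s) = h (b, t)) : contraction L vs h = 0 := by
  set e : Equiv.Perm (Fin 3 × Fin d) := Equiv.swap (b, s) (b, t) with he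
  have hcomp : ∀ x, h (e x) = h x := by
    intro x
    rw [he, Equiv.swap_apply_def]
    split_ifs with h1 h2
    · rw [h1, hh]
    · rw [h2, hh]
    · rfl
  have : contraction L vs h = -contraction L vs h := by
    conv_lhs => rw [contraction, ← Equiv.sum_comp (e.symm.arrowCongr (Equiv.refl (Fin d)))]
    rw [contraction, ← Finset.sum_neg_distrib]
    refine Finset.sum_congr rfl fun I _ => ?_
    have hI : (e.symm.arrowCongr (Equiv.refl (Fin d))) I = I ∘ e := by
      ext x; simp [Equiv.arrowCongr]
    rw [hI, he, leviProd_swap I b hst, ← he, neg_mul]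
    have h1 : ∀ v i z, vertexFactor h (fun x => ((I ∘ e) x : ℕ)) v i z =
        vertexFactor h (fun x => I x) v i z := by
      intro v i z
      unfold vertexFactor
      rw [← Equiv.prod_comp e fun x => if h x = v then (if (I x : ℕ) = i then z else 0) else 1]
      simp only [hcomp, Function.comp_apply]
    have h2 : fixedFactor h (fun x => ((I ∘ e) x : ℕ)) = fixedFactor h (fun x => I x) := by
      unfold fixedFactor
      rw [← Equiv.prod_comp e fun x =>
        if 10 ≤ h x then (if (I x : ℕ) + 10 = h x then (1 : ℤ) else 0) else 1]
      simp only [hcomp, Function.comp_apply]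
    simp only [h1, h2]
  linarith

/-- The sum over the terms in `v` is expanded. A chosen term contributes its exponent once for each
incoming edge and forces the index of these edges, which is recorded by replacing the head `v` with
`10 + p.1`. -/
theorem contraction_cons (v : ℕ) (vs : List ℕ) (h : Fin 3 × Fin d → ℕ) (hv : v < 10)
    (hvs : ∀ u ∈ vs, u < 10) (hmem : v ∉ vs) :
    contraction L (v :: vs) h = ((L (codeClass v)).map fun p =>
      ((∏ e, if h e = v then p.2 else 1 : ℤ) : ℝ) *
        contraction L vs (substCode v (10 + p.1) ∘ h)).sum := by
  have factor : ∀ (i : ℕ) (z : ℤ) (I : Fin 3 × Fin d → ℕ),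
      vertexFactor h I v i z * fixedFactor h I =
        (∏ e, if h e = v then z else 1) * fixedFactor (substCode v (10 + i) ∘ h) I := by
    intro i z I
    unfold vertexFactor fixedFactor
    rw [← Finset.prod_mul_distrib, ← Finset.prod_mul_distrib]
    refine Finset.prod_congr rfl fun e _ => ?_
    rw [Function.comp_apply, substCode_eq]
    by_cases he : h e = v
    · have h10 : ¬ 10 ≤ h e := by omega
      simp only [if_pos he, if_neg h10, Nat.le_add_right, if_true]
      by_cases hi : I e = i
      · simp [hi, add_comm]
      · have : ¬ I e + 10 = 10 + i := by omega
        simp [hi, this]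
    · simp only [if_neg he]
  have other : ∀ (i : ℕ) (I : Fin 3 × Fin d → ℕ) (u : ℕ), u ∈ vs → ∀ (j : ℕ) (z : ℤ),
      vertexFactor h I u j z = vertexFactor (substCode v (10 + i) ∘ h) I u j z := by
    intro i I u hu j z
    unfold vertexFactor
    refine Finset.prod_congr rfl fun e _ => ?_
    have h1 := hvs u hu
    have h2 : u ≠ v := fun h => hmem (h ▸ hu)
    have : (substCode v (10 + i) ∘ h) e = u ↔ h e = u := by
      rw [Function.comp_apply, substCode_eq]
      split_ifs with he
      · omega
      · rfl
    simp only [this]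
  have hsum : ∀ (l : List (Fin d × ℤ)), (∑ I : Fin 3 × Fin d → Fin d, leviProd I *
      (((l.map fun p => vertexFactor h (fun e => I e) v p.1 p.2).sum *
        (vs.map fun v => ((L (codeClass v)).map fun p =>
        vertexFactor h (fun e => I e) v p.1 p.2).sum).prod *
          fixedFactor h (fun e => I e) : ℤ) : ℝ)) = (l.map fun p =>
      ((∏ e, if h e = v then p.2 else 1 : ℤ) : ℝ) *
        contraction L vs (substCode v (10 + p.1) ∘ h)).sum := by
    intro l
    induction l with
    | nil => simp
    | cons p l ih =>
      rw [List.map_cons, List.sum_cons, ← ih, contraction, Finset.mul_sum,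
        ← Finset.sum_add_distrib]
      refine Finset.sum_congr rfl fun I _ => ?_
      have hprod : (vs.map fun v => ((L (codeClass v)).map fun p =>
          vertexFactor h (fun e => I e) v p.1 p.2).sum) =
          vs.map fun u => ((L (codeClass u)).map fun q =>
          vertexFactor (substCode v (10 + p.1) ∘ h) (fun e => I e) u q.1 q.2).sum := by
        refine List.map_congr_left fun u hu => ?_
        simp only [other p.1 (fun e => I e) u hu]
      have hp := factor p.1 p.2 fun e => I e
      rw [← hprod, List.map_cons, List.sum_cons, mul_left_comm, ← mul_add, ← Int.cast_mul,
        ← Int.cast_add]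
      congr 2
      linear_combination (vs.map fun v => ((L (codeClass v)).map fun p =>
          vertexFactor h (fun e => I e) v p.1 p.2).sum).prod * hp
  exact hsum _

/-- Without incoming edges the content is not differentiated, and each exponential has the value 1
at the origin. -/
theorem contraction_cons_of_forall_ne (v : ℕ) (vs : List ℕ) (h : Fin 3 × Fin d → ℕ)
    (hv : ∀ e, h e ≠ v) :
    contraction L (v :: vs) h = (L (codeClass v)).length * contraction L vs h := by
  unfold contraction
  rw [Finset.mul_sum]
  refine Finset.sum_congr rfl fun I _ => ?_
  have : ∀ i z, vertexFactor h (fun e => I e) v i z = 1 := fun i z =>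
    Finset.prod_eq_one fun e _ => if_neg (hv e)
  simp only [List.map_cons, List.prod_cons, this, List.map_const', List.sum_replicate]
  push_cast
  simp
  ring

/-- Once all vertices are expanded, the heads prescribe every index and a single summand survives.
-/
theorem contraction_nil (h : Fin 3 × Fin d → ℕ) (hh : ∀ e, ∃ i : Fin d, h e = 10 + i) :
    ∃ J : Fin 3 × Fin d → Fin d, (∀ e, h e = 10 + J e) ∧ contraction L [] h = leviProd J := by
  choose J hJ using hh
  refine ⟨J, hJ, ?_⟩
  unfold contraction
  rw [Finset.sum_eq_single J]
  · have : fixedFactor h (fun e => J e) = 1 :=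
      Finset.prod_eq_one fun e _ => by simp [hJ, add_comm]
    simp [this]
  · intro I _ hI
    obtain ⟨e, he⟩ := Function.ne_iff.1 hI
    have : fixedFactor h (fun e => I e) = 0 := by
      refine Finset.prod_eq_zero (Finset.mem_univ e) ?_
      have h1 : ¬ (I e : ℕ) + 10 = h e := fun h' => he (Fin.ext (by rw [hJ] at h'; omega))
      rw [if_neg h1, if_pos (by rw [hJ]; omega)]
    simp [this]
  · simp

theorem exists_heads_eq_iff {rows : List (List ℕ)} (h : IsTable d rows) (v : ℕ) :
    (∃ r ∈ rows, v ∈ r) ↔ ∃ e, heads d rows e = v := by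
  obtain ⟨r₀, r₁, r₂, rfl, h₀, h₁, h₂⟩ := h.eq_three
  have key : ∀ r : List ℕ, r.length = d → (v ∈ r ↔ ∃ s : Fin d, r.getD s 0 = v) := by
    rintro r rfl
    rw [List.mem_iff_get]
    simp
  simp only [List.mem_cons, List.not_mem_nil, or_false, exists_eq_or_imp, exists_eq_left,
    key _ h₀, key _ h₁, key _ h₂, Prod.exists, Fin.exists_fin_succ, heads]
  simp

theorem exists_repeated {rows : List (List ℕ)} (h : IsTable d rows) {v w : ℕ} (hvw : v ≠ w)
    (hr : ∃ r ∈ rows, v ∈ r ∧ w ∈ r) :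
    ∃ b s t, s ≠ t ∧ heads d rows (b, s) = v ∧ heads d rows (b, t) = w := by
  obtain ⟨r, hr, hv, hw⟩ := hr
  obtain ⟨b, hb, rfl⟩ := List.getElem_of_mem hr
  obtain ⟨s, hs, hsv⟩ := List.getElem_of_mem hv
  obtain ⟨t, ht, htw⟩ := List.getElem_of_mem hw
  have hd : (rows[b]).length = d := h.2 _ (List.getElem_mem hb)
  refine ⟨⟨b, h.1 ▸ hb⟩, ⟨s, hd ▸ hs⟩, ⟨t, hd ▸ ht⟩, ?_, ?_, ?_⟩
  · rintro hst
    rw [Fin.mk.injEq] at hst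
    subst hst
    exact hvw (hsv.symm.trans htw)
  · simp [heads, hb, hs, hsv]
  · simp [heads, hb, ht, htw]

theorem prod_heads {rows : List (List ℕ)} (h : IsTable d rows) (F : ℕ → ℤ) :
    ∏ e, F (heads d rows e) = (rows.map fun r => (r.map F).prod).prod := by
  obtain ⟨r₀, r₁, r₂, rfl, h₀, h₁, h₂⟩ := h.eq_three
  have key : ∀ r : List ℕ, r.length = d → ∏ s : Fin d, F (r.getD s 0) = (r.map F).prod := by
    rintro r rfl
    rw [← List.prod_ofFn]
    congr 1
    refine List.ext_getElem (by simp) fun i h1 h2 => ?_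
    simp
  rw [Fintype.prod_prod_type, Fin.prod_univ_three]
  simp only [List.map_cons, List.map_nil, List.prod_cons, List.prod_nil, mul_one, ← key _ h₀,
    ← key _ h₁, ← key _ h₂, mul_assoc]
  rfl

theorem contraction_eq_expValue (vs : List ℕ) {rows : List (List ℕ)} (h : IsTable d rows)
    (hvs : ∀ u ∈ vs, u < 10) (hnd : vs.Nodup)
    (hrows : ∀ e, heads d rows e ∈ vs ∨ ∃ i : Fin d, heads d rows e = 10 + i) :
    contraction L vs (heads d rows) = expValue L vs rows := by
  induction vs generalizing rows with
  | nil =>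
    obtain ⟨J, hJ, hc⟩ := contraction_nil L (heads d rows) (by simpa using hrows)
    rw [hc, expValue_nil, leviProd, Fin.prod_univ_three]
    obtain ⟨r₀, r₁, r₂, rfl, h₀, h₁, h₂⟩ := h.eq_three
    rw [leviCivita_eq_levi 10 _ r₀ h₀ fun s => hJ (0, s),
      leviCivita_eq_levi 10 _ r₁ h₁ fun s => hJ (1, s),
      leviCivita_eq_levi 10 _ r₂ h₂ fun s => hJ (2, s)]
    simp [mul_assoc]
  | cons v vs ih =>
    have hv : v < 10 := hvs v (by simp)
    have hvs' : ∀ u ∈ vs, u < 10 := fun u hu => hvs u (by simp [hu])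
    obtain ⟨hmem, hnd'⟩ := List.nodup_cons.1 hnd
    rw [expValue_cons]
    simp only [exists_heads_eq_iff h v]
    split_ifs with hex
    · rw [contraction_cons L v vs _ hv hvs' hmem, Int.cast_list_sum, List.map_map]
      congr 1
      refine List.map_congr_left fun p _ => ?_
      rw [Function.comp_apply, ← heads_map h]
      split_ifs with hc
      -- After the substitution, two edges of one copy would carry the same index.
      · obtain ⟨b, s, t, hst, hs, ht⟩ := exists_repeated h (by omega) hc
        rw [contraction_eq_zero_of_repeated L vs _ hst, mul_zero, Int.cast_zero]
        rw [heads_map h, Function.comp_apply, Function.comp_apply, hs, ht, substCode_eq,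
          substCode_eq]
        simp
      · rw [ih (h.map _) hvs' hnd', prod_heads h fun u => if u = v then p.2 else 1, Int.cast_mul]
        intro e
        rw [heads_map h, Function.comp_apply, substCode_eq]
        split_ifs with he
        · exact Or.inr ⟨p.1, rfl⟩
        · rcases hrows e with h1 | h1
          · exact Or.inl ((List.mem_cons.1 h1).resolve_left he)
          · exact Or.inr h1
    · push Not at hex
      rw [contraction_cons_of_forall_ne L v vs _ hex, ih h hvs' hnd' fun e =>
        (hrows e).imp_left fun h1 => (List.mem_cons.1 h1).resolve_left (hex e)]
      push_cast
      rfl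

theorem amplitude_expJet (N : ℕ) (vs : List ℕ) (hperm : vs.Perm (List.range N))
    (h : Fin 3 × Fin d → ℕ) (hh : ∀ e, h e < 10) :
    amplitude N (fun κ s => (expJet (L κ) s : ℝ)) h = contraction L vs h := by
  unfold amplitude contraction
  refine Finset.sum_congr rfl fun I _ => congrArg _ ?_
  have hfix : fixedFactor h (fun e => I e) = 1 :=
    Finset.prod_eq_one fun e _ => if_neg (by have := hh e; omega)
  rw [hfix, mul_one, (hperm.map _).prod_eq, ← Int.cast_prod]
  congr 1
  change _ = ∏ v ∈ Finset.range N, _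
  refine Finset.prod_congr rfl fun v _ => ?_
  unfold expJet
  congr 1
  refine List.map_congr_left fun p _ => ?_
  unfold vertexFactor incomingIndices
  rw [Multiset.map_map, ← Finset.prod_filter]
  refine Finset.prod_congr rfl fun e _ => ?_
  simp only [derivFactor, Function.comp_apply, Fin.ext_iff]

/-- Any order `vs` of expansion of the vertices gives the same value, so it may be chosen for the
cost of the evaluation. The bound on `N` keeps the vertex codes apart from the codes `10 + i`. -/
theorem amplitude_eq_expValue (N : ℕ) (hN : N ≤ 10) (vs : List ℕ)
    (hperm : vs.Perm (List.range N)) {rows : List (List ℕ)} (h : IsTable d rows)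
    (hh : ∀ e, heads d rows e < N) :
    amplitude N (fun κ s => (expJet (L κ) s : ℝ)) (heads d rows) = expValue L vs rows := by
  rw [amplitude_expJet L N vs hperm _ fun e => (hh e).trans_le hN,
    contraction_eq_expValue L vs h]
  · intro u hu
    exact (List.mem_range.1 (hperm.mem_iff.1 hu)).trans_le hN
  · exact hperm.nodup_iff.2 List.nodup_range
  · exact fun e => Or.inl (hperm.mem_iff.2 (List.mem_range.2 (hh e)))

end Contraction

/-! ### Parametrization of the descendants by independent choices. -/

section Keys

variable {c : ℕ}

/-- Parameters of a descendant of the sunflower: the second edge of the first copy is a loop (`0`)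
or enters the vertex number `x` of the second copy (`x + 1`); the other numbers tell which vertex
of the copy is entered by the respective edge, where `0` is the Levi-Civita vertex. -/
abbrev Key (c : ℕ) : Type :=
  Fin (c + 2) × Fin (c + 1) × Fin (c + 1) × Fin (c + 1) × Fin (c + 1)

/-- The vertices of the copy `b` which an external edge can enter. -/
def target (x : Fin (c + 1)) (b : Fin 3) : Vertex 1 3 c :=
  Fin.cases (Vertex.top b) (fun k => Vertex.casimir k b) x

/-- The head of the second edge of the first copy. -/
def petal (y : Fin (c + 2)) : Vertex 1 3 c :=
  Fin.cases (Vertex.top 0) (fun x => target x 1) y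

/-- The micro-graph with the given parameters. -/
def keyGraph (k : Key c) : MicroGraph 1 3 c :=
  ![![Vertex.sink 0, petal k.1], ![target k.2.1 0, target k.2.2.1 2],
    ![target k.2.2.2.1 0, target k.2.2.2.2 1]]

/-- The numbers of the Casimirs of a copy. -/
def casimirCodes (c b : ℕ) : List ℕ := (List.range c).map fun k => targetCode (k + 1) b

/-- The table of heads of a micro-graph with the given parameters. -/
def keyRows (k : Key c) : List (List ℕ) :=
  [0 :: (if (k.1 : ℕ) = 0 then 1 else targetCode (k.1 - 1) 1) :: casimirCodes c 0,
   targetCode k.2.1 0 :: targetCode k.2.2.1 2 :: casimirCodes c 1,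
   targetCode k.2.2.2.1 0 :: targetCode k.2.2.2.2 1 :: casimirCodes c 2]

theorem target_injective (b : Fin 3) : Function.Injective fun x : Fin (c + 1) => target x b := by
  intro x y h
  cases x using Fin.cases <;> cases y using Fin.cases <;> simp_all [target]

theorem target_ne_top {b b' : Fin 3} (h : b ≠ b') (x : Fin (c + 1)) :
    target x b ≠ Vertex.top b' := by
  cases x using Fin.cases <;> simp [target, h]

theorem petal_injective : Function.Injective (petal (c := c)) := by
  intro x y h
  cases x using Fin.cases with
  | zero =>
    cases y using Fin.cases with
    | zero => rfl
    | succ y => exact absurd h.symm (target_ne_top (by decide) y)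
  | succ x =>
    cases y using Fin.cases with
    | zero => exact absurd h (target_ne_top (by decide) x)
    | succ y => rw [target_injective 1 h]

theorem keyGraph_injective : Function.Injective (keyGraph (c := c)) := by
  rintro ⟨y, x₁, x₂, x₃, x₄⟩ ⟨y', x₁', x₂', x₃', x₄'⟩ h
  have h0 : petal y = petal y' := congrFun (congrFun h 0) 1
  have h1 : target x₁ 0 = target x₁' 0 := congrFun (congrFun h 1) 0
  have h2 : target x₂ 2 = target x₂' 2 := congrFun (congrFun h 1) 1
  have h3 : target x₃ 0 = target x₃' 0 := congrFun (congrFun h 2) 0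
  have h4 : target x₄ 1 = target x₄' 1 := congrFun (congrFun h 2) 1
  rw [petal_injective h0, target_injective 0 h1, target_injective 2 h2, target_injective 0 h3,
    target_injective 1 h4]

theorem eq_keyGraph_iff (k : Key c) (H : MicroGraph 1 3 c) :
    H = keyGraph k ↔ H 0 0 = Vertex.sink 0 ∧ H 0 1 = petal k.1 ∧ H 1 0 = target k.2.1 0 ∧
      H 1 1 = target k.2.2.1 2 ∧ H 2 0 = target k.2.2.2.1 0 ∧ H 2 1 = target k.2.2.2.2 1 := by
  constructor
  · rintro rfl
    exact ⟨rfl, rfl, rfl, rfl, rfl, rfl⟩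
  · rintro ⟨h1, h2, h3, h4, h5, h6⟩
    ext b s
    fin_cases b <;> fin_cases s <;> assumption

theorem vertexCode_target (x : Fin (c + 1)) (b : Fin 3) :
    vertexCode (target x b) = targetCode x b := by
  cases x using Fin.cases <;> rfl

theorem isTable_keyRows (k : Key c) : IsTable (c + 2) (keyRows k) :=
  isTable_three (by simp [casimirCodes]) (by simp [casimirCodes]) (by simp [casimirCodes])

theorem vertexCode_head_keyGraph (k : Key c) (b : Fin 3) (s : Fin (c + 2)) :
    vertexCode (head (keyGraph k) b s) = heads (c + 2) (keyRows k) (b, s) := by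
  have hpetal : vertexCode (petal k.1) =
      if (k.1 : ℕ) = 0 then 1 else targetCode (k.1 - 1) 1 := by
    obtain ⟨y, -⟩ := k
    cases y using Fin.cases with
    | zero => rfl
    | succ y => exact (vertexCode_target y 1).trans (by simp)
  cases s using Fin.cases with
  | zero => fin_cases b <;> first | rfl | exact vertexCode_target _ _
  | succ s =>
    cases s using Fin.cases with
    | zero => fin_cases b <;> first | exact hpetal | exact vertexCode_target _ _
    | succ s => fin_cases b <;> simp [head, heads, keyRows, casimirCodes, vertexCode]

theorem vertexCode_lt (v : Vertex 1 3 c) : vertexCode v < 3 * (c + 1) + 1 := by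
  rcases v with j | b | ⟨k, b⟩ <;> simp only [vertexCode, targetCode] <;> omega

theorem vanishes_of_provablyZero (k : Key c) (n : ℕ)
    (h : provablyZero (c + 1) n (keyRows k) = true) : Vanishes (keyGraph k) := by
  intro ρ a f hρ ha hf x
  rw [formula_eq_amplitude (keyGraph k) _ (vertexCode_head_keyGraph k) ρ a f x
    -- Classes are 0 for the sink, 1 for the Levi-Civita vertices and `k + 2` for the Casimir `k`.
    -- The default 0 is never reached: the vertices that occur have class at most `c + 1`.
    (fun κ s => if κ = 0 then jet (f 0) x s else if κ = 1 then jet ρ x s else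
      if hκ : κ - 2 < c then jet (a ⟨κ - 2, hκ⟩) x s else 0)
    (fun l => by simpa using iterPartial_eq_jet (hf 0) x l)
    (fun l => by simpa using iterPartial_eq_jet hρ x l)
    (fun i l => by simpa using iterPartial_eq_jet (ha i) x l)]
  exact amplitude_eq_zero_of_provablyZero _ n (isTable_keyRows k) h

theorem not_vanishes_of_expValue_ne_zero (k : Key c) (hc : 3 * (c + 1) + 1 ≤ 10)
    (L : ℕ → List (Fin (c + 2) × ℤ)) (vs : List ℕ)
    (hvs : vs.Perm (List.range (3 * (c + 1) + 1))) (h : expValue L vs (keyRows k) ≠ 0) :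
    ¬ Vanishes (keyGraph k) := by
  intro hv
  have := hv (expSum (L 1)) (fun i => expSum (L (i + 2))) (fun _ => expSum (L 0))
    (contDiff_expSum _) (fun _ => contDiff_expSum _) (fun _ => contDiff_expSum _) 0
  rw [formula_eq_amplitude (keyGraph k) _ (vertexCode_head_keyGraph k) _ _ _ 0
    (fun κ s => (expJet (L κ) s : ℝ)) (iterPartial_expSum_zero _) (iterPartial_expSum_zero _)
    (fun _ => iterPartial_expSum_zero _),
    amplitude_eq_expValue L _ hc vs hvs (isTable_keyRows k) fun e => by
      rw [← vertexCode_head_keyGraph]; exact vertexCode_lt _] at this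
  exact h (by exact_mod_cast this)

theorem forall_edges (P : Fin 3 → Fin 2 → Prop) :
    (∀ b s, P b s) ↔ P 0 0 ∧ P 0 1 ∧ P 1 0 ∧ P 1 1 ∧ P 2 0 ∧ P 2 1 := by
  simp only [Fin.forall_fin_succ, IsEmpty.forall_iff, and_true]
  tauto

theorem eq_top_or_casimir_iff (w : Vertex 1 3 c) {b b' : Fin 3} (hb : b' ≠ b) :
    (w = Vertex.top b' ∨ (b' ≠ b ∧ ∃ k, w = Vertex.casimir k b')) ↔ ∃ x, w = target x b' := by
  rw [Fin.exists_fin_succ]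
  simp [target, hb]

/-- The two graphs of the sunflower differ only in the second edge of the first copy. The loop has
one descendant head and the other edge has `c + 1`, which gives the factor `Fin (c + 2)` in `Key`;
the four remaining edges have `c + 1` choices each. -/
theorem sunflowerDescendants_eq_range :
    sunflowerDescendants c = Set.range (keyGraph (c := c)) := by
  have loop : ∀ w : Vertex 1 3 c, (w = Vertex.top 0 ∨ ((0 : Fin 3) ≠ 0 ∧
      ∃ k, w = Vertex.casimir k 0)) ↔ w = Vertex.top 0 := by simp
  have h10 := fun w : Vertex 1 3 c => eq_top_or_casimir_iff w (b := 1) (b' := 0) (by decide)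
  have h12 := fun w : Vertex 1 3 c => eq_top_or_casimir_iff w (b := 1) (b' := 2) (by decide)
  have h20 := fun w : Vertex 1 3 c => eq_top_or_casimir_iff w (b := 2) (b' := 0) (by decide)
  have h21 := fun w : Vertex 1 3 c => eq_top_or_casimir_iff w (b := 2) (b' := 1) (by decide)
  have h01 := fun w : Vertex 1 3 c => eq_top_or_casimir_iff w (b := 0) (b' := 1) (by decide)
  ext H
  constructor
  · rintro ⟨G, rfl | rfl, hG⟩
    · obtain ⟨e0, e1, e2, e3, e4, e5⟩ := (forall_edges _).1 hG
      obtain ⟨x₁, e2⟩ := (h10 _).1 e2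
      obtain ⟨x₂, e3⟩ := (h12 _).1 e3
      obtain ⟨x₃, e4⟩ := (h20 _).1 e4
      obtain ⟨x₄, e5⟩ := (h21 _).1 e5
      exact ⟨(0, x₁, x₂, x₃, x₄), Eq.symm <| (eq_keyGraph_iff _ _).2
        ⟨e0, (loop _).1 e1, e2, e3, e4, e5⟩⟩
    · obtain ⟨e0, e1, e2, e3, e4, e5⟩ := (forall_edges _).1 hG
      obtain ⟨x₀, e1⟩ := (h01 _).1 e1
      obtain ⟨x₁, e2⟩ := (h10 _).1 e2
      obtain ⟨x₂, e3⟩ := (h12 _).1 e3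
      obtain ⟨x₃, e4⟩ := (h20 _).1 e4
      obtain ⟨x₄, e5⟩ := (h21 _).1 e5
      exact ⟨(x₀.succ, x₁, x₂, x₃, x₄), Eq.symm <| (eq_keyGraph_iff _ _).2
        ⟨e0, e1, e2, e3, e4, e5⟩⟩
  · rintro ⟨⟨y, x₁, x₂, x₃, x₄⟩, rfl⟩
    cases y using Fin.cases with
    | zero =>
      exact ⟨_, Or.inl rfl, (forall_edges _).2 ⟨rfl, (loop _).2 rfl, (h10 _).2 ⟨x₁, rfl⟩,
        (h12 _).2 ⟨x₂, rfl⟩, (h20 _).2 ⟨x₃, rfl⟩, (h21 _).2 ⟨x₄, rfl⟩⟩⟩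
    | succ x₀ =>
      exact ⟨_, Or.inr rfl, (forall_edges _).2 ⟨rfl, (h01 _).2 ⟨x₀, rfl⟩, (h10 _).2 ⟨x₁, rfl⟩,
        (h12 _).2 ⟨x₂, rfl⟩, (h20 _).2 ⟨x₃, rfl⟩, (h21 _).2 ⟨x₄, rfl⟩⟩⟩

end Keys

/-! ### Descent from dimension three to dimension four. -/

section Descent

/-- The vertex of a copy over dimension three from which a vertex over dimension four descends. -/
def targetOrigin (x : Fin 3) : Fin 2 := ![0, 1, 1] x

/-- The parameters of the micro-graph over dimension three from which a micro-graph over dimension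
four descends. -/
def keyOrigin (k : Key 2) : Key 1 :=
  (![0, 1, 2, 2] k.1, targetOrigin k.2.1, targetOrigin k.2.2.1, targetOrigin k.2.2.2.1,
    targetOrigin k.2.2.2.2)

/-- The condition on an edge issued from the copy `b` in the definition of `IsDescendant`. -/
def EdgeDescends (b : Fin 3) (v : Vertex 1 3 1) (w : Vertex 1 3 2) : Prop :=
  match v with
  | Vertex.sink j => w = Vertex.sink j
  | Vertex.top b' => w = Vertex.top b'
  | Vertex.casimir k b' => w = Vertex.casimir k.castSucc b' ∨
      (b' ≠ b ∧ w = Vertex.casimir (Fin.last 1) b')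

theorem edgeDescends_target {b b' : Fin 3} (hb : b' ≠ b) (x : Fin 2) (w : Vertex 1 3 2) :
    EdgeDescends b (target x b') w ↔ ∃ x', w = target x' b' ∧ targetOrigin x' = x := by
  fin_cases x
  · constructor
    · exact fun h => ⟨0, h, rfl⟩
    · rintro ⟨x', h, hx⟩
      fin_cases x'
      · exact h
      · exact absurd hx (by decide)
      · exact absurd hx (by decide)
  · constructor
    · rintro (h | ⟨-, h⟩)
      · exact ⟨1, h, rfl⟩
      · exact ⟨2, h, rfl⟩
    · rintro ⟨x', h, hx⟩
      fin_cases x'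
      · exact absurd hx (by decide)
      · exact Or.inl h
      · exact Or.inr ⟨hb, h⟩

theorem edgeDescends_petal (y : Fin 3) (w : Vertex 1 3 2) :
    EdgeDescends 0 (petal y) w ↔
      ∃ y' : Fin 4, w = petal y' ∧ (![0, 1, 2, 2] : Fin 4 → Fin 3) y' = y := by
  have hlift : ∀ x' : Fin 3,
      (![0, 1, 2, 2] : Fin 4 → Fin 3) x'.succ = (targetOrigin x').succ := by decide
  cases y using Fin.cases with
  | zero =>
    rw [Fin.exists_fin_succ]
    simp [hlift, Fin.succ_ne_zero, petal, EdgeDescends]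
  | succ x =>
    rw [Fin.exists_fin_succ]
    simp only [hlift, Fin.succ_inj]
    refine (edgeDescends_target (by decide) x w).trans ?_
    simp [(Fin.succ_ne_zero x).symm, petal]

/-- No free edge of a `keyGraph` enters a Casimir of its own copy, so each edge into a Casimir may
run over both. Descent is then the fibre of `keyOrigin`, and counting descendants of a set becomes
counting a preimage. -/
theorem isDescendant_keyGraph_iff (k : Key 1) (H : MicroGraph 1 3 2) :
    IsDescendant (keyGraph k) H ↔ ∃ k', keyOrigin k' = k ∧ keyGraph k' = H := by
  have h : IsDescendant (keyGraph k) H ↔ ∀ b s, EdgeDescends b (keyGraph k b s) (H b s) := by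
    refine forall_congr' fun b => forall_congr' fun s => ?_
    generalize keyGraph k b s = v
    cases v <;> rfl
  rw [h, forall_edges]
  constructor
  · rintro ⟨e0, e1, e2, e3, e4, e5⟩
    obtain ⟨y, e1, h1⟩ := (edgeDescends_petal _ _).1 e1
    obtain ⟨x₁, e2, h2⟩ := (edgeDescends_target (by decide) _ _).1 e2
    obtain ⟨x₂, e3, h3⟩ := (edgeDescends_target (by decide) _ _).1 e3
    obtain ⟨x₃, e4, h4⟩ := (edgeDescends_target (by decide) _ _).1 e4
    obtain ⟨x₄, e5, h5⟩ := (edgeDescends_target (by decide) _ _).1 e5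
    refine ⟨(y, x₁, x₂, x₃, x₄), ?_, Eq.symm <| (eq_keyGraph_iff _ _).2
      ⟨e0, e1, e2, e3, e4, e5⟩⟩
    simp only [keyOrigin, h1, h2, h3, h4, h5]
  · rintro ⟨k', rfl, rfl⟩
    exact ⟨rfl, (edgeDescends_petal _ _).2 ⟨_, rfl, rfl⟩,
      (edgeDescends_target (by decide) _ _).2 ⟨_, rfl, rfl⟩,
      (edgeDescends_target (by decide) _ _).2 ⟨_, rfl, rfl⟩,
      (edgeDescends_target (by decide) _ _).2 ⟨_, rfl, rfl⟩,
      (edgeDescends_target (by decide) _ _).2 ⟨_, rfl, rfl⟩⟩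

end Descent

/-! ### Isomorphism is an equivalence relation. -/

section Isomorphism

theorem Isomorphic.refl {m n c : ℕ} (G : MicroGraph m n c) : Isomorphic G G :=
  ⟨1, fun _ => 1, fun b s => by cases h : G b s <;> simp [Vertex.relabel, h]⟩

theorem Vertex.relabel_relabel {m n c : ℕ} (π π' : Equiv.Perm (Fin n)) (v : Vertex m n c) :
    (v.relabel π).relabel π' = v.relabel (π' * π) := by
  cases v <;> rfl

theorem Isomorphic.symm {m n c : ℕ} {G H : MicroGraph m n c} (h : Isomorphic G H) :
    Isomorphic H G := by
  obtain ⟨π, τ, h⟩ := h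
  refine ⟨π.symm, fun b => (τ (π.symm b)).symm, fun b s => ?_⟩
  have key := h (π.symm b) ((τ (π.symm b)).symm s)
  rw [Equiv.apply_symm_apply, Equiv.apply_symm_apply] at key
  have hπ : π.symm * π = 1 := by ext; simp
  rw [key, Vertex.relabel_relabel, hπ]
  cases G (π.symm b) s <;> rfl

theorem Isomorphic.trans {m n c : ℕ} {G H K : MicroGraph m n c} (h : Isomorphic G H)
    (h' : Isomorphic H K) : Isomorphic G K := by
  obtain ⟨π, τ, h⟩ := h
  obtain ⟨π', τ', h'⟩ := h'
  refine ⟨π' * π, fun b => τ b * τ' (π b), fun b s => ?_⟩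
  rw [Equiv.Perm.mul_apply, h', h, Vertex.relabel_relabel]
  rfl

end Isomorphism

/-! ### Finite checks and the resulting counts. -/

section Evaluations

/-- The function given by a list of lists. -/
def ofTable {d : ℕ} (l : List (List (Fin d × ℤ))) (n : ℕ) : List (Fin d × ℤ) := l.getD n []

/-- The test with exponential sums of the given table yields zero. -/
def expVanishes {c : ℕ} (vs : List ℕ) (l : List (List (Fin (c + 2) × ℤ))) (k : Key c) : Bool :=
  match tableForce (keyRows k) (expValue (ofTable l) vs) with
  | Int.ofNat n => Nat.beq n 0
  | Int.negSucc _ => false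

theorem expValue_ne_zero {c : ℕ} {vs : List ℕ} {l : List (List (Fin (c + 2) × ℤ))} {k : Key c}
    (h : expVanishes vs l k = false) : expValue (ofTable l) vs (keyRows k) ≠ 0 := by
  intro h0
  rw [expVanishes, tableForce_eq, h0] at h
  exact absurd h (by decide)

/-- The test for micro-graphs over dimension three. -/
def test₃ (k : Key 1) : Bool :=
  expVanishes [0, 4, 1, 2, 3, 5, 6]
    [[(0, 1)], [(1, 1), (2, -2), (0, 2)], [(0, 1), (1, 1), (2, 1)]] k

/-- The tests for micro-graphs over dimension four. -/
def test₄ (k : Key 2) : Bool :=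
  [[[(0, 1)], [(3, 1), (2, 1)], [(0, 1), (1, 2), (2, 1)], [(1, 1), (3, -2), (0, 1)]],
   [[(0, 1)], [(0, 1), (3, -1)], [(2, 3), (1, -1), (0, -2)], [(3, -2), (3, 1), (1, 1), (2, 2)]],
   [[(0, 1)], [(1, 3), (2, 1)], [(3, 2), (3, 1), (1, -1), (2, 2)], [(2, -1), (3, 2), (0, 3)]]].all
    fun l => expVanishes [0, 4, 7, 1, 2, 3, 5, 8, 6, 9] l k

/-- The parameters of the vanishing descendants over dimension three. -/
def vanishingKeys : Finset (Key 1) :=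
  {(0, 0, 1, 1, 1), (0, 1, 1, 0, 1), (1, 0, 0, 1, 0), (1, 0, 0, 1, 1), (1, 0, 1, 1, 1),
    (1, 1, 1, 0, 1), (2, 0, 0, 1, 0), (2, 0, 0, 1, 1), (2, 0, 1, 1, 0), (2, 1, 0, 0, 0),
    (2, 1, 0, 1, 1), (2, 1, 1, 0, 0), (2, 1, 1, 1, 1)}

/-- A single choice of exponentials already detects every non-vanishing key in dimension three. -/
theorem test₃_iff : ∀ k, test₃ k = true ↔ k ∈ vanishingKeys := by
  decide +kernel

theorem provablyZero_of_mem_vanishingKeys :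
    ∀ k ∈ vanishingKeys, provablyZero 2 2 (keyRows k) = true := by
  decide +kernel

/-- The first conclusion shows that the three tests miss no non-vanishing graph. The second is the
essential content of the last equality of the theorem. -/
theorem test₄_spec : ∀ k, test₄ k = true →
    provablyZero 3 2 (keyRows k) = true ∧ keyOrigin k ∈ vanishingKeys := by
  decide +kernel

theorem card_test₄ : (Finset.univ.filter fun k => test₄ k = true).card = 54 := by
  decide +kernel

theorem card_keyOrigin :
    (Finset.univ.filter fun k => keyOrigin k ∈ vanishingKeys).card = 118 := by
  decide +kernel

instance {m n c : ℕ} (G H : MicroGraph m n c) : Decidable (Isomorphic G H) := by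
  unfold Isomorphic
  infer_instance

/-- With the loop in the first copy, the second and third copies play symmetric roles; their
interchange swaps the two pairs of parameters. -/
theorem isomorphic_pair :
    Isomorphic (keyGraph (c := 1) (0, 0, 1, 1, 1)) (keyGraph (0, 1, 1, 0, 1)) := by
  decide +kernel

/-- An exhaustive check over the 48 relabellings of each pair: six permutations of copies and eight
choices of swaps. -/
theorem eq_of_isomorphic : ∀ k ∈ vanishingKeys.erase (0, 1, 1, 0, 1),
    ∀ k' ∈ vanishingKeys.erase (0, 1, 1, 0, 1),
    Isomorphic (keyGraph k) (keyGraph k') → k = k' := by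
  decide +kernel

theorem vanishes_iff_mem_vanishingKeys (k : Key 1) :
    Vanishes (keyGraph k) ↔ k ∈ vanishingKeys := by
  refine ⟨fun h => ?_, fun h => vanishes_of_provablyZero k 2
    (provablyZero_of_mem_vanishingKeys k h)⟩
  by_contra hk
  have ht : test₃ k = false := by simpa using mt (test₃_iff k).1 hk
  exact not_vanishes_of_expValue_ne_zero k (by decide) _ _ (by decide) (expValue_ne_zero ht) h

theorem vanishes_iff_test₄ (k : Key 2) : Vanishes (keyGraph k) ↔ test₄ k = true := by
  refine ⟨fun h => ?_, fun h => vanishes_of_provablyZero k 2 (test₄_spec k h).1⟩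
  by_contra hk
  rw [test₄, List.all_eq_true] at hk
  push Not at hk
  obtain ⟨l, -, hl⟩ := hk
  exact not_vanishes_of_expValue_ne_zero k (by decide) _ [0, 4, 7, 1, 2, 3, 5, 8, 6, 9]
    (by decide) (expValue_ne_zero (by simpa using hl)) h

theorem sunflowerVan_eq_image {c : ℕ} :
    sunflowerVan c = keyGraph '' {k : Key c | Vanishes (keyGraph k)} := by
  ext H
  simp only [sunflowerVan, sunflowerDescendants_eq_range, Set.mem_ofPred_eq, Set.mem_image]
  constructor
  · rintro ⟨⟨k, rfl⟩, h⟩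
    exact ⟨k, h, rfl⟩
  · rintro ⟨k, h, rfl⟩
    exact ⟨⟨k, rfl⟩, h⟩

theorem ncard_image_keyGraph {c : ℕ} (S : Finset (Key c)) :
    (keyGraph '' (S : Set (Key c))).ncard = S.card := by
  rw [Set.ncard_image_of_injective _ keyGraph_injective, Set.ncard_coe_finset]

theorem ncard_sunflowerDescendants (c : ℕ) :
    (sunflowerDescendants c).ncard = (c + 2) * (c + 1) ^ 4 := by
  rw [sunflowerDescendants_eq_range, ← Set.image_univ, ← Finset.coe_univ, ncard_image_keyGraph,
    Finset.card_univ]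
  simp only [Fintype.card_prod, Fintype.card_fin]
  ring

theorem sunflowerVan_one : sunflowerVan 1 = keyGraph '' (vanishingKeys : Set (Key 1)) := by
  rw [sunflowerVan_eq_image]
  congr 1
  ext k
  exact vanishes_iff_mem_vanishingKeys k

theorem sunflowerVan_two : sunflowerVan 2 =
    keyGraph '' ((Finset.univ.filter fun k : Key 2 => test₄ k = true : Finset (Key 2)) :
      Set (Key 2)) := by
  rw [sunflowerVan_eq_image]
  congr 1
  ext k
  simpa using vanishes_iff_test₄ k

theorem descendants_sunflowerVan_one : descendants (sunflowerVan 1) =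
    keyGraph '' ((Finset.univ.filter fun k : Key 2 => keyOrigin k ∈ vanishingKeys :
      Finset (Key 2)) : Set (Key 2)) := by
  ext H
  rw [sunflowerVan_one]
  constructor
  · rintro ⟨_, ⟨k, hk, rfl⟩, hH⟩
    obtain ⟨k', rfl, rfl⟩ := (isDescendant_keyGraph_iff k H).1 hH
    exact ⟨k', by simpa using hk, rfl⟩
  · rintro ⟨k', hk, rfl⟩
    exact ⟨_, ⟨keyOrigin k', by simpa using hk, rfl⟩,
      (isDescendant_keyGraph_iff _ _).2 ⟨k', rfl, rfl⟩⟩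

theorem ncard_isomorphism_classes :
    ((fun G => {H | Isomorphic G H}) '' sunflowerVan 1).ncard = 12 := by
  have hset : (fun G => {H | Isomorphic G H}) '' sunflowerVan 1 =
      (fun k : Key 1 => {H | Isomorphic (keyGraph k) H}) ''
        (vanishingKeys.erase (0, 1, 1, 0, 1) : Finset (Key 1)) := by
    rw [sunflowerVan_one, Set.image_image]
    refine Set.Subset.antisymm ?_ (Set.image_mono (Finset.coe_subset.2 (Finset.erase_subset _ _)))
    rintro _ ⟨k, hk, rfl⟩
    by_cases h : k = (0, 1, 1, 0, 1)
    · subst h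
      -- The erased key has the same isomorphism class as its mirror image, so the image is
      -- unchanged and twelve classes remain.
      refine ⟨(0, 0, 1, 1, 1), Finset.mem_coe.2 (by decide), ?_⟩
      ext H
      exact ⟨isomorphic_pair.symm.trans, isomorphic_pair.trans⟩
    · exact ⟨k, Finset.mem_coe.2 (Finset.mem_erase.2 ⟨h, hk⟩), rfl⟩
  rw [hset, Set.InjOn.ncard_image, Set.ncard_coe_finset]
  · decide
  · intro k hk k' hk' h
    refine eq_of_isomorphic k hk k' hk' ?_
    have : keyGraph k' ∈ {H | Isomorphic (keyGraph k') H} := Isomorphic.refl _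
    rw [← show {H | Isomorphic (keyGraph k) H} = {H | Isomorphic (keyGraph k') H} from h] at this
    exact this

end Evaluations

end NambuMicro

/-- Dimension `3` is `c = 1` Casimir, dimension `4` is `c = 2` Casimirs. -/
theorem proposition1 :
    (NambuMicro.sunflowerDescendants 1).ncard = 48 ∧
    (NambuMicro.sunflowerVan 1).ncard = 13 ∧
    ((fun G => {H | NambuMicro.Isomorphic G H}) '' NambuMicro.sunflowerVan 1).ncard = 12 ∧
    (NambuMicro.sunflowerDescendants 2).ncard = 324 ∧
    (NambuMicro.sunflowerVan 2).ncard = 54 ∧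
    (NambuMicro.descendants (NambuMicro.sunflowerVan 1)).ncard = 118 ∧
    NambuMicro.sunflowerVan 2 =
      {H | H ∈ NambuMicro.descendants (NambuMicro.sunflowerVan 1) ∧ NambuMicro.Vanishes H} := by
  refine ⟨NambuMicro.ncard_sunflowerDescendants 1, ?_, NambuMicro.ncard_isomorphism_classes,
    NambuMicro.ncard_sunflowerDescendants 2, ?_, ?_, ?_⟩
  · rw [NambuMicro.sunflowerVan_one, NambuMicro.ncard_image_keyGraph]
    decide
  · rw [NambuMicro.sunflowerVan_two, NambuMicro.ncard_image_keyGraph]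
    exact NambuMicro.card_test₄
  · rw [NambuMicro.descendants_sunflowerVan_one, NambuMicro.ncard_image_keyGraph]
    exact NambuMicro.card_keyOrigin
  · rw [NambuMicro.descendants_sunflowerVan_one, NambuMicro.sunflowerVan_two]
    ext H
    constructor
    · rintro ⟨k, hk, rfl⟩
      have ht : NambuMicro.test₄ k = true := by simpa using hk
      exact ⟨⟨k, by simpa using (NambuMicro.test₄_spec k ht).2, rfl⟩,
        (NambuMicro.vanishes_iff_test₄ k).2 ht⟩
    -- In this direction the origin of `k` is irrelevant: every 4D-descendant in question is a
    -- descendant of the sunflower, and it vanishes by assumption.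
    · rintro ⟨⟨k, -, rfl⟩, hv⟩
      exact ⟨k, by simpa using (NambuMicro.vanishes_iff_test₄ k).1 hv, rfl⟩
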